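/- Let $K$ be a field and let $Q=(Q_0,Q_1,s,r)$ be an arbitrary quiver. Let $\widehat Q$ be its Kronecker square, that is, the quiver with vertex set $Q_0\times Q_0$ and arrow set $Q_1\times Q_1$, where the arrow $[e,f]$ has source $[s(e),s(f)]$ and range $[r(e),r(f)]$. For a quiver $E$, let $L_K(E)$ denote its Leavitt path algebra: the associative (not necessarily unital) $K$-algebra generated by $\{v,e,e^*: v\in E_0,\ e\in E_1\}$ subject to the relations (1) $vw=\delta_{v,w}v$ for all $v,w\in E_0$; (2) $s(e)e=e=e\,r(e)$ for all $e\in E_1$; (3) $r(e)e^*=e^*=e^*s(e)$ for all $e\in E_1$; (4) $e^*f=\delta_{e,f}\,r(e)$ for all $e,f\in E_1$; (5) $v=\sum_{e\in E_1,\ s(e)=v}ee^*$ for every vertex $v$ that emits at least one and only finitely many arrows. A (not necessarily unital) ring $R$ is von Neumann regular if for every $a\in R$ there is $b\in R$ with $aba=a$; it is left (right) noetherian if its left (right) ideals satisfy the ascending chain condition, and left (right) artinian if they satisfy the descending chain condition. **Theorem.** 1. $L_K(Q)$ is von Neumann regular if and only if $L_K(\widehat Q)$ is von Neumann regular. 2.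 $L_K(Q)$ is left noetherian if and only if $L_K(\widehat Q)$ is left noetherian, and $L_K(Q)$ is right noetherian if and only if $L_K(\widehat Q)$ is right noetherian. 3. $L_K(Q)$ is left artinian if and only if $L_K(\widehat Q)$ is left artinian, and $L_K(Q)$ is right artinian if and only if $L_K(\widehat Q)$ is right artinian. -/

import Mathlib

universe u v w

/-! ### Chain conditions and regularity for rings that need not have an identity -/

section RingProperties

variable (R : Type u) [NonUnitalRing R]

/-- A left ideal of a (not necessarily unital) ring: an additive subgroup `I` with `R I ⊆ I`. -/
structure NonUnitalLeftIdeal extends AddSubgroup R where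
  mul_mem_left : ∀ (r : R) {x : R}, x ∈ carrier → r * x ∈ carrier

/-- A right ideal of a (not necessarily unital) ring: an additive subgroup `I` with `I R ⊆ I`. -/
structure NonUnitalRightIdeal extends AddSubgroup R where
  mul_mem_right : ∀ (r : R) {x : R}, x ∈ carrier → x * r ∈ carrier

/-- Left ideals are ordered by inclusion. -/
instance NonUnitalLeftIdeal.instPartialOrder : PartialOrder (NonUnitalLeftIdeal R) :=
  PartialOrder.lift NonUnitalLeftIdeal.toAddSubgroup
    (by rintro ⟨I, hI⟩ ⟨J, hJ⟩ h; cases h; rfl)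

/-- Right ideals are ordered by inclusion. -/
instance NonUnitalRightIdeal.instPartialOrder : PartialOrder (NonUnitalRightIdeal R) :=
  PartialOrder.lift NonUnitalRightIdeal.toAddSubgroup
    (by rintro ⟨I, hI⟩ ⟨J, hJ⟩ h; cases h; rfl)

/-- Von Neumann regularity: every `a` can be written as `a b a`. -/
def IsVonNeumannRegular : Prop := ∀ a : R, ∃ b : R, a * b * a = a

/-- Ascending chain condition on left ideals. -/
def IsLeftNoetherian : Prop := WellFoundedGT (NonUnitalLeftIdeal R)

/-- Ascending chain condition on right ideals. -/
def IsRightNoetherian : Prop := WellFoundedGT (NonUnitalRightIdeal R)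

/-- Descending chain condition on left ideals. -/
def IsLeftArtinian : Prop := WellFoundedLT (NonUnitalLeftIdeal R)

/-- Descending chain condition on right ideals. -/
def IsRightArtinian : Prop := WellFoundedLT (NonUnitalRightIdeal R)

end RingProperties

/-! ### The Kronecker square of a quiver -/

/-- The vertex set of the Kronecker square of a quiver with vertex set `V`. -/
def KroneckerSquare (V : Type u) : Type u := V × V

/-- The arrows `[e, f]` of the Kronecker square are the pairs of arrows of the quiver, with
`s [e, f] = [s e, s f]` and `r [e, f] = [r e, r f]`. -/
instance KroneckerSquare.instQuiver (V : Type u) [Quiver.{v} V] :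
    Quiver.{v} (KroneckerSquare V) where
  Hom a b := (a.1 ⟶ b.1) × (a.2 ⟶ b.2)

/-! ### Leavitt path algebras -/

/-- The type of all arrows of a quiver; the arrow `⟨a, b, e⟩` has source `a` and range `b`. -/
abbrev QuiverArrow (V : Type u) [Quiver.{v} V] : Type (max u v) := Σ a b : V, (a ⟶ b)

/-- The source of an arrow. -/
abbrev QuiverArrow.s {V : Type u} [Quiver.{v} V] (e : QuiverArrow V) : V := e.1

/-- The range of an arrow. -/
abbrev QuiverArrow.r {V : Type u} [Quiver.{v} V] (e : QuiverArrow V) : V := e.2.1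

/-- The generators of the Leavitt path algebra: vertices, arrows and ghost arrows. -/
inductive LeavittGen (V : Type u) [Quiver.{v} V] : Type (max u v)
  | vertex (a : V) : LeavittGen V
  | arrow (e : QuiverArrow V) : LeavittGen V
  | ghost (e : QuiverArrow V) : LeavittGen V

section LeavittPathAlgebra

variable (K : Type w) [Field K] (V : Type u) [Quiver.{v} V]

/-- The free (non-unital) associative `K`-algebra on the generators, realised as the semigroup
algebra of the free semigroup. -/
abbrev LeavittFree : Type (max u v w) := MonoidAlgebra K (FreeSemigroup (LeavittGen V))

variable {V}

/-- A generator, as an element of the free algebra. -/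
noncomputable def LeavittFree.gen (x : LeavittGen V) : LeavittFree K V :=
  MonoidAlgebra.single (FreeSemigroup.of x) 1

/-- A vertex, as an element of the free algebra. -/
noncomputable abbrev LeavittFree.vertex (a : V) : LeavittFree K V := .gen K (.vertex a)

/-- An arrow `e`, as an element of the free algebra. -/
noncomputable abbrev LeavittFree.arrow (e : QuiverArrow V) : LeavittFree K V := .gen K (.arrow e)

/-- A ghost arrow `e*`, as an element of the free algebra. -/
noncomputable abbrev LeavittFree.ghost (e : QuiverArrow V) : LeavittFree K V := .gen K (.ghost e)

open LeavittFree in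
/-- The defining relations of the Leavitt path algebra. The arrows with source `a` form the type
`Quiver.Star a`, so that `a` is a regular vertex if and only if that type is finite and nonempty. -/
inductive LeavittRel : LeavittFree K V → LeavittFree K V → Prop
  | vertex_mul_self (a : V) : LeavittRel (vertex K a * vertex K a) (vertex K a)
  | vertex_mul_of_ne (a b : V) : a ≠ b → LeavittRel (vertex K a * vertex K b) 0
  | source_mul_arrow (e : QuiverArrow V) : LeavittRel (vertex K e.s * arrow K e) (arrow K e)
  | arrow_mul_range (e : QuiverArrow V) : LeavittRel (arrow K e * vertex K e.r) (arrow K e)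
  | range_mul_ghost (e : QuiverArrow V) : LeavittRel (vertex K e.r * ghost K e) (ghost K e)
  | ghost_mul_source (e : QuiverArrow V) : LeavittRel (ghost K e * vertex K e.s) (ghost K e)
  | ck1_self (e : QuiverArrow V) : LeavittRel (ghost K e * arrow K e) (vertex K e.r)
  | ck1_of_ne (e f : QuiverArrow V) : e ≠ f → LeavittRel (ghost K e * arrow K f) 0
  | ck2 (a : V) [Fintype (Quiver.Star a)] [Nonempty (Quiver.Star a)] :
      LeavittRel (vertex K a) (∑ e : Quiver.Star a, arrow K ⟨a, e⟩ * ghost K ⟨a, e⟩)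

/-- The least `K`-algebra congruence on the free algebra that contains the defining relations. -/
inductive LeavittEquiv : LeavittFree K V → LeavittFree K V → Prop
  | of {x y : LeavittFree K V} : LeavittRel K x y → LeavittEquiv x y
  | refl (x : LeavittFree K V) : LeavittEquiv x x
  | symm {x y : LeavittFree K V} : LeavittEquiv x y → LeavittEquiv y x
  | trans {x y z : LeavittFree K V} : LeavittEquiv x y → LeavittEquiv y z → LeavittEquiv x z
  | add {x y z t : LeavittFree K V} :
      LeavittEquiv x y → LeavittEquiv z t → LeavittEquiv (x + z) (y + t)
  | mul {x y z t : LeavittFree K V} :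
      LeavittEquiv x y → LeavittEquiv z t → LeavittEquiv (x * z) (y * t)
  | smul (k : K) {x y : LeavittFree K V} : LeavittEquiv x y → LeavittEquiv (k • x) (k • y)

variable (V)

/-- `LeavittEquiv` as a bundled ring congruence. -/
def leavittCon : RingCon (LeavittFree K V) where
  r := LeavittEquiv K
  iseqv := ⟨.refl, .symm, .trans⟩
  add' := .add
  mul' := .mul

/-- The Leavitt path algebra `L_K(Q)` of the quiver `Q` with vertex set `V`. It has an identity
only if `V` is finite. -/
def LeavittPathAlgebra : Type (max u v w) := (leavittCon K V).Quotient

noncomputable instance LeavittPathAlgebra.instNonUnitalRing :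
    NonUnitalRing (LeavittPathAlgebra K V) :=
  inferInstanceAs (NonUnitalRing (leavittCon K V).Quotient)

/-- The scalar multiplication of the Leavitt path algebra, induced by that of the free algebra. -/
noncomputable instance LeavittPathAlgebra.instModule : Module K (LeavittPathAlgebra K V) where
  smul k := Quotient.map (fun x : LeavittFree K V => k • x) fun _ _ h => LeavittEquiv.smul k h
  one_smul := by
    rintro ⟨x⟩
    exact congrArg (fun y : LeavittFree K V => (y : (leavittCon K V).Quotient)) (one_smul K x)
  mul_smul := by
    rintro k l ⟨x⟩
    exact congrArg (fun y : LeavittFree K V => (y : (leavittCon K V).Quotient)) (mul_smul k l x)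
  smul_zero k :=
    congrArg (fun y : LeavittFree K V => (y : (leavittCon K V).Quotient)) (smul_zero k)
  smul_add := by
    rintro k ⟨x⟩ ⟨y⟩
    exact congrArg (fun y : LeavittFree K V => (y : (leavittCon K V).Quotient)) (smul_add k x y)
  add_smul := by
    rintro k l ⟨x⟩
    exact congrArg (fun y : LeavittFree K V => (y : (leavittCon K V).Quotient)) (add_smul k l x)
  zero_smul := by
    rintro ⟨x⟩
    exact congrArg (fun y : LeavittFree K V => (y : (leavittCon K V).Quotient)) (zero_smul K x)

instance LeavittPathAlgebra.instIsScalarTower :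
    IsScalarTower K (LeavittPathAlgebra K V) (LeavittPathAlgebra K V) where
  smul_assoc := by
    rintro k ⟨x⟩ ⟨y⟩
    exact congrArg (fun y : LeavittFree K V => (y : (leavittCon K V).Quotient))
      (smul_mul_assoc k x y)

instance LeavittPathAlgebra.instSMulCommClass :
    SMulCommClass K (LeavittPathAlgebra K V) (LeavittPathAlgebra K V) where
  smul_comm := by
    rintro k ⟨x⟩ ⟨y⟩
    exact congrArg (fun y : LeavittFree K V => (y : (leavittCon K V).Quotient))
      (mul_smul_comm k x y).symm

end LeavittPathAlgebra

/-! Each property is governed by the shape of the quiver. The algebra is regular exactly when there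
are no closed paths; left artinian exactly when, moreover, there are finitely many vertices and
arrows; left noetherian exactly when there are finitely many vertices and arrows and no closed path
has an exit, i.e. a vertex on a closed path emits only one arrow. These conditions pass between the
quiver and its Kronecker square: closed paths lift to the diagonal and project to the coordinates,
and the arrows leaving `[a, b]` are the pairs of arrows leaving `a` and `b`. The involution that
swaps arrows and ghost arrows settles the right-handed versions.

Necessity: a closed path `c` at `v` can be made to act on a vector over the Laurent polynomials as a
power `T^n`. Since `1 - T^n` is not invertible, `v - c` has no generalized inverse, and divisibility
by powers of `1 - T^n` yields a descending chain of left ideals. Infinitely many vertices, an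
infinite emitter or an exit yield infinite orthogonal families, which violate both chain conditions.

Sufficiency: without closed paths every element lies in the span of finitely many finite systems of
matrix units, and matrices over a field are regular; for a finite quiver the algebra is even
finite-dimensional. Without exits a shortest closed path `c` at `w` satisfies `cc* = w = c*c`, and
`wL` lies in a finitely generated module over a noetherian ring generated by `c` and `c*`. The
remaining vertices reduce to cycles and sinks by relation (5). -/

namespace LeavittPathAlgebra

/-! ### Relations, words and the universal property -/

variable (K : Type w) [Field K] {V : Type u} [Quiver.{v} V]

/-- The quotient map from the free algebra to the Leavitt path algebra. -/
noncomputable def mk : LeavittFree K V →ₙₐ[K] LeavittPathAlgebra K V where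
  toFun x := (x : (leavittCon K V).Quotient)
  map_smul' _ _ := rfl
  map_zero' := rfl
  map_add' _ _ := rfl
  map_mul' _ _ := rfl

variable {K}

theorem mk_eq_of_rel {x y : LeavittFree K V} (h : LeavittRel K x y) : mk K x = mk K y :=
  Quotient.sound (LeavittEquiv.of h)

theorem mk_surjective : Function.Surjective (mk K : LeavittFree K V → LeavittPathAlgebra K V) := by
  rintro ⟨x⟩
  exact ⟨x, rfl⟩

variable (K)

/-- A generator, as an element of the Leavitt path algebra. -/
noncomputable def gen (x : LeavittGen V) : LeavittPathAlgebra K V := mk K (LeavittFree.gen K x)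

/-- A vertex, as an element of the Leavitt path algebra. -/
noncomputable def vertex (a : V) : LeavittPathAlgebra K V := gen K (.vertex a)

/-- An arrow, as an element of the Leavitt path algebra. -/
noncomputable def arrow (e : QuiverArrow V) : LeavittPathAlgebra K V := gen K (.arrow e)

/-- A ghost arrow, as an element of the Leavitt path algebra. -/
noncomputable def ghost (e : QuiverArrow V) : LeavittPathAlgebra K V := gen K (.ghost e)

variable {K}

@[simp]
theorem vertex_mul_self (a : V) : vertex K a * vertex K a = vertex K a := by
  simpa [vertex, arrow, ghost, gen] using mk_eq_of_rel (LeavittRel.vertex_mul_self (K := K) a)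

theorem vertex_mul_of_ne {a b : V} (h : a ≠ b) : vertex K a * vertex K b = 0 := by
  simpa [vertex, arrow, ghost, gen] using mk_eq_of_rel (LeavittRel.vertex_mul_of_ne (K := K) a b h)

theorem source_mul_arrow (e : QuiverArrow V) : vertex K e.s * arrow K e = arrow K e := by
  simpa [vertex, arrow, ghost, gen] using mk_eq_of_rel (LeavittRel.source_mul_arrow (K := K) e)

theorem arrow_mul_range (e : QuiverArrow V) : arrow K e * vertex K e.r = arrow K e := by
  simpa [vertex, arrow, ghost, gen] using mk_eq_of_rel (LeavittRel.arrow_mul_range (K := K) e)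

theorem range_mul_ghost (e : QuiverArrow V) : vertex K e.r * ghost K e = ghost K e := by
  simpa [vertex, arrow, ghost, gen] using mk_eq_of_rel (LeavittRel.range_mul_ghost (K := K) e)

theorem ghost_mul_source (e : QuiverArrow V) : ghost K e * vertex K e.s = ghost K e := by
  simpa [vertex, arrow, ghost, gen] using mk_eq_of_rel (LeavittRel.ghost_mul_source (K := K) e)

theorem ghost_mul_arrow_self (e : QuiverArrow V) : ghost K e * arrow K e = vertex K e.r := by
  simpa [vertex, arrow, ghost, gen] using mk_eq_of_rel (LeavittRel.ck1_self (K := K) e)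

theorem ghost_mul_arrow_of_ne {e f : QuiverArrow V} (h : e ≠ f) :
    ghost K e * arrow K f = 0 := by
  simpa [vertex, arrow, ghost, gen] using mk_eq_of_rel (LeavittRel.ck1_of_ne (K := K) e f h)

theorem vertex_eq_sum (a : V) [Fintype (Quiver.Star a)] [Nonempty (Quiver.Star a)] :
    vertex K a = ∑ e : Quiver.Star a, arrow K ⟨a, e⟩ * ghost K ⟨a, e⟩ := by
  simpa [vertex, arrow, ghost, gen] using mk_eq_of_rel (LeavittRel.ck2 (K := K) a)

theorem vertex_mul_arrow_of_ne {a : V} {e : QuiverArrow V} (h : a ≠ e.s) :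
    vertex K a * arrow K e = 0 := by
  rw [← source_mul_arrow, ← mul_assoc, vertex_mul_of_ne h, zero_mul]

theorem arrow_mul_vertex_of_ne {a : V} {e : QuiverArrow V} (h : e.r ≠ a) :
    arrow K e * vertex K a = 0 := by
  rw [← arrow_mul_range, mul_assoc, vertex_mul_of_ne h, mul_zero]

theorem ghost_mul_vertex_of_ne {a : V} {e : QuiverArrow V} (h : e.s ≠ a) :
    ghost K e * vertex K a = 0 := by
  rw [← ghost_mul_source, mul_assoc, vertex_mul_of_ne h, mul_zero]

theorem vertex_mul_ghost_of_ne {a : V} {e : QuiverArrow V} (h : a ≠ e.r) :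
    vertex K a * ghost K e = 0 := by
  rw [← range_mul_ghost, ← mul_assoc, vertex_mul_of_ne h, zero_mul]

/-- The Leavitt path algebra is spanned by the nonempty words in the generators. -/
theorem induction_words {p : LeavittPathAlgebra K V → Prop} (zero : p 0)
    (add : ∀ x y, p x → p y → p (x + y)) (smul : ∀ (k : K) x, p x → p (k • x))
    (base : ∀ g, p (gen K g)) (gen_mul : ∀ g x, p x → p (gen K g * x))
    (x : LeavittPathAlgebra K V) : p x := by
  obtain ⟨x, rfl⟩ := mk_surjective x
  induction x using MonoidAlgebra.induction_linear with
  | zero => simpa using zero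
  | add x y hx hy => simpa using add _ _ hx hy
  | single w k =>
    have h : (MonoidAlgebra.single w k : LeavittFree K V) = k • MonoidAlgebra.single w 1 := by
      simp
    rw [h, map_smul]
    refine smul k _ ?_
    clear h
    induction w with
    | ih1 g => exact base g
    | ih2 g w _ hw =>
      have h : (MonoidAlgebra.single (FreeSemigroup.of g * w) 1 : LeavittFree K V) =
          LeavittFree.gen K g * MonoidAlgebra.single w 1 := by
        simp [LeavittFree.gen, MonoidAlgebra.single_mul_single]
      rw [h, map_mul]
      exact gen_mul g _ hw

section Lift

variable {A : Type*} [NonUnitalRing A] [Module K A] [IsScalarTower K A A] [SMulCommClass K A A]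

/-- The algebra homomorphism out of the free algebra with prescribed values on generators. -/
noncomputable def freeLift (f : LeavittGen V → A) : LeavittFree K V →ₙₐ[K] A :=
  MonoidAlgebra.liftMagma K (FreeSemigroup.lift f)

@[simp]
theorem freeLift_gen (f : LeavittGen V → A) (g : LeavittGen V) :
    freeLift f (LeavittFree.gen K g) = f g := by
  simp [freeLift, LeavittFree.gen]

theorem freeLift_eq_of_equiv {f : LeavittGen V → A}
    (hf : ∀ x y : LeavittFree K V, LeavittRel K x y → freeLift f x = freeLift f y)
    {x y : LeavittFree K V} (h : LeavittEquiv K x y) : freeLift f x = freeLift f y := by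
  induction h with
  | of h => exact hf _ _ h
  | refl => rfl
  | symm _ h => exact h.symm
  | trans _ _ h₁ h₂ => exact h₁.trans h₂
  | add _ _ h₁ h₂ => rw [map_add, map_add, h₁, h₂]
  | mul _ _ h₁ h₂ => rw [map_mul, map_mul, h₁, h₂]
  | smul k _ h => rw [map_smul, map_smul, h]

/-- The universal property of the Leavitt path algebra. -/
noncomputable def lift (f : LeavittGen V → A)
    (hf : ∀ x y : LeavittFree K V, LeavittRel K x y → freeLift f x = freeLift f y) :
    LeavittPathAlgebra K V →ₙₐ[K] A where
  toFun := Quotient.lift (freeLift f) fun _ _ h => freeLift_eq_of_equiv hf h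
  map_smul' := by
    rintro k ⟨x⟩
    exact map_smul (freeLift f) k x
  map_zero' := map_zero (freeLift f)
  map_add' := by
    rintro ⟨x⟩ ⟨y⟩
    exact map_add (freeLift f) x y
  map_mul' := by
    rintro ⟨x⟩ ⟨y⟩
    exact map_mul (freeLift f) x y

theorem lift_gen (f : LeavittGen V → A)
    (hf : ∀ x y : LeavittFree K V, LeavittRel K x y → freeLift f x = freeLift f y)
    (g : LeavittGen V) : lift f hf (gen K g) = f g :=
  freeLift_gen f g

end Lift

/-! ### The involution and left-right symmetry -/

section Involution

open MulOpposite

variable (K V) in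
/-- The involution of the Leavitt path algebra, which exchanges arrows and ghost arrows, as a
homomorphism to the opposite algebra. -/
noncomputable def starHom : LeavittPathAlgebra K V →ₙₐ[K] (LeavittPathAlgebra K V)ᵐᵒᵖ :=
  lift (fun g => match g with
    | .vertex a => op (vertex K a)
    | .arrow e => op (ghost K e)
    | .ghost e => op (arrow K e)) <| by
    rintro _ _ (a | ⟨a, b, h⟩ | e | e | e | e | e | ⟨e, f, h⟩ | @⟨a, _, _⟩)
    · simp [← op_mul]
    · simp [← op_mul, vertex_mul_of_ne h.symm]
    · simp [← op_mul, ghost_mul_source]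
    · simp [← op_mul, range_mul_ghost]
    · simp [← op_mul, arrow_mul_range]
    · simp [← op_mul, source_mul_arrow]
    · simp [← op_mul, ghost_mul_arrow_self]
    · simp [← op_mul, ghost_mul_arrow_of_ne h.symm]
    · simp [← op_mul, vertex_eq_sum a]

/-- The involution of the Leavitt path algebra. -/
noncomputable def inv (x : LeavittPathAlgebra K V) : LeavittPathAlgebra K V := unop (starHom K V x)

theorem inv_add (x y : LeavittPathAlgebra K V) : inv (x + y) = inv x + inv y := by
  simp [inv]

theorem inv_zero : inv (0 : LeavittPathAlgebra K V) = 0 := by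
  simp [inv]

theorem inv_smul (k : K) (x : LeavittPathAlgebra K V) : inv (k • x) = k • inv x := by
  simp [inv]

theorem inv_neg (x : LeavittPathAlgebra K V) : inv (-x) = -inv x := by
  simp [inv]

theorem inv_mul (x y : LeavittPathAlgebra K V) : inv (x * y) = inv y * inv x := by
  simp [inv]

theorem inv_inv_gen (g : LeavittGen V) : inv (inv (gen K g)) = gen K g := by
  cases g <;> simp [inv, starHom, lift_gen, vertex, arrow, ghost]

@[simp]
theorem inv_inv (x : LeavittPathAlgebra K V) : inv (inv x) = x := by
  induction x using induction_words with
  | zero => simp [inv_zero]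
  | add x y hx hy => rw [inv_add, inv_add, hx, hy]
  | smul k x hx => rw [inv_smul, inv_smul, hx]
  | base g => exact inv_inv_gen g
  | gen_mul g x hx => rw [inv_mul, inv_mul, hx, inv_inv_gen]

/-- The involution exchanges left ideals and right ideals. -/
noncomputable def leftIdealOrderIso :
    NonUnitalLeftIdeal (LeavittPathAlgebra K V) ≃o NonUnitalRightIdeal (LeavittPathAlgebra K V) where
  toFun I :=
    { carrier := {x | inv x ∈ I.carrier}
      zero_mem' := by simp [inv_zero]
      add_mem' := fun hx hy => by simpa [inv_add] using I.add_mem' hx hy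
      neg_mem' := fun hx => by simpa [inv_neg] using I.neg_mem' hx
      mul_mem_right := fun r x hx => by simpa [inv_mul] using I.mul_mem_left (inv r) hx }
  invFun I :=
    { carrier := {x | inv x ∈ I.carrier}
      zero_mem' := by simp [inv_zero]
      add_mem' := fun hx hy => by simpa [inv_add] using I.add_mem' hx hy
      neg_mem' := fun hx => by simpa [inv_neg] using I.neg_mem' hx
      mul_mem_left := fun r x hx => by simpa [inv_mul] using I.mul_mem_right (inv r) hx }
  left_inv := by
    rintro ⟨⟨⟨⟨I, _⟩, _⟩, _⟩, _⟩
    simp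
  right_inv := by
    rintro ⟨⟨⟨⟨I, _⟩, _⟩, _⟩, _⟩
    simp
  map_rel_iff' := by
    intro I J
    constructor
    · intro h x hx
      have := @h (inv x) (by simpa using hx)
      simpa using this
    · intro h x hx
      exact h hx

theorem isRightNoetherian_iff :
    IsRightNoetherian (LeavittPathAlgebra K V) ↔ IsLeftNoetherian (LeavittPathAlgebra K V) :=
  ⟨fun h => @StrictMono.wellFoundedGT _ _ _ _ _ h leftIdealOrderIso.strictMono,
    fun h => @StrictMono.wellFoundedGT _ _ _ _ _ h leftIdealOrderIso.symm.strictMono⟩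

theorem isRightArtinian_iff :
    IsRightArtinian (LeavittPathAlgebra K V) ↔ IsLeftArtinian (LeavittPathAlgebra K V) :=
  ⟨fun h => @StrictMono.wellFoundedLT _ _ _ _ _ h leftIdealOrderIso.strictMono,
    fun h => @StrictMono.wellFoundedLT _ _ _ _ _ h leftIdealOrderIso.symm.strictMono⟩

end Involution

end LeavittPathAlgebra

/-! ### Paths and reachability -/

section Paths

variable {V : Type u} [Quiver.{v} V]

/-- The source of the list of arrows `l`, regarded as a path that ends at `b`. -/
def QuiverArrow.source : List (QuiverArrow V) → V → V
  | [], b => b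
  | e :: _, _ => e.s

/-- The list of arrows `l` is a path that ends at `b`. -/
def QuiverArrow.IsPath : List (QuiverArrow V) → V → Prop
  | [], _ => True
  | e :: l, b => e.r = source l b ∧ IsPath l b

namespace QuiverArrow

@[simp]
theorem source_nil (b : V) : source [] b = b := rfl

@[simp]
theorem source_cons (e : QuiverArrow V) (l : List (QuiverArrow V)) (b : V) :
    source (e :: l) b = e.s := rfl

@[simp]
theorem isPath_nil (b : V) : IsPath [] b := trivial

@[simp]
theorem isPath_cons {e : QuiverArrow V} {l : List (QuiverArrow V)} {b : V} :
    IsPath (e :: l) b ↔ e.r = source l b ∧ IsPath l b := Iff.rfl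

@[simp]
theorem source_append (l m : List (QuiverArrow V)) (b : V) :
    source (l ++ m) b = source l (source m b) := by
  cases l <;> rfl

theorem isPath_append {l m : List (QuiverArrow V)} {b : V} :
    IsPath (l ++ m) b ↔ IsPath l (source m b) ∧ IsPath m b := by
  induction l with
  | nil => simp
  | cons e l ih => simp [ih, and_assoc]

end QuiverArrow

/-- There is a path of positive length from `a` to `b`. -/
def QuiverReach (a b : V) : Prop := Relation.TransGen (fun a b : V => Nonempty (a ⟶ b)) a b

theorem QuiverReach.trans {a b c : V} (h : QuiverReach a b) (h' : QuiverReach b c) :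
    QuiverReach a c :=
  Relation.TransGen.trans h h'

theorem QuiverReach.arrow (e : QuiverArrow V) : QuiverReach e.s e.r :=
  .single ⟨e.2.2⟩

open QuiverArrow

theorem QuiverReach.exists_isPath {a b : V} (h : QuiverReach a b) :
    ∃ l : List (QuiverArrow V), l ≠ [] ∧ IsPath l b ∧ source l b = a := by
  induction h using Relation.TransGen.head_induction_on with
  | single h =>
    obtain ⟨e⟩ := h
    exact ⟨[⟨_, _, e⟩], by simp⟩
  | head h _ ih =>
    obtain ⟨e⟩ := h
    obtain ⟨l, -, hl, hs⟩ := ih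
    exact ⟨⟨_, _, e⟩ :: l, by simp [hl, hs]⟩

theorem QuiverArrow.IsPath.reach {l : List (QuiverArrow V)} {b : V} (hl : IsPath l b)
    (hne : l ≠ []) : QuiverReach (source l b) b := by
  induction l with
  | nil => exact absurd rfl hne
  | cons e l ih =>
    rw [isPath_cons] at hl
    have he := QuiverReach.arrow e
    rcases eq_or_ne l [] with rfl | h
    · rwa [hl.1] at he
    · rw [hl.1] at he
      exact he.trans (ih hl.2 h)

theorem QuiverArrow.IsPath.reach_source {e : QuiverArrow V} {l : List (QuiverArrow V)} {b : V}
    (hl : IsPath (e :: l) b) {f : QuiverArrow V} (hf : f ∈ l) : QuiverReach e.s f.s := by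
  obtain ⟨l₁, l₂, rfl⟩ := List.append_of_mem hf
  rw [← List.cons_append, isPath_append] at hl
  exact hl.1.reach (List.cons_ne_nil _ _)

end Paths

/-! ### Paths as elements of the algebra -/

namespace LeavittPathAlgebra

open QuiverArrow

section PathElements

variable (K : Type w) [Field K] {V : Type u} [Quiver.{v} V]

/-- The product of the list of arrows `l`, followed by the vertex `b`. It vanishes unless `l` is a
path that ends at `b`. -/
noncomputable def path : List (QuiverArrow V) → V → LeavittPathAlgebra K V
  | [], b => vertex K b
  | e :: l, b => arrow K e * path l b

/-- The image of `path K l b` under the involution. -/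
noncomputable def ghostPath : List (QuiverArrow V) → V → LeavittPathAlgebra K V
  | [], b => vertex K b
  | e :: l, b => ghostPath l b * ghost K e

@[simp]
theorem path_nil (b : V) : path K [] b = vertex K b := rfl

theorem path_cons (e : QuiverArrow V) (l : List (QuiverArrow V)) (b : V) :
    path K (e :: l) b = arrow K e * path K l b := rfl

@[simp]
theorem ghostPath_nil (b : V) : ghostPath K [] b = vertex K b := rfl

theorem ghostPath_cons (e : QuiverArrow V) (l : List (QuiverArrow V)) (b : V) :
    ghostPath K (e :: l) b = ghostPath K l b * ghost K e := rfl

variable {K}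

theorem source_mul_path (l : List (QuiverArrow V)) (b : V) :
    vertex K (source l b) * path K l b = path K l b := by
  cases l with
  | nil => simp
  | cons e l => rw [path_cons, ← mul_assoc, source_cons, source_mul_arrow]

theorem vertex_mul_path_of_ne {a b : V} {l : List (QuiverArrow V)} (h : a ≠ source l b) :
    vertex K a * path K l b = 0 := by
  rw [← source_mul_path, ← mul_assoc, vertex_mul_of_ne h, zero_mul]

theorem ghostPath_mul_source (l : List (QuiverArrow V)) (b : V) :
    ghostPath K l b * vertex K (source l b) = ghostPath K l b := by
  cases l with
  | nil => simp
  | cons e l => rw [ghostPath_cons, mul_assoc, source_cons, ghost_mul_source]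

theorem ghostPath_mul_vertex_of_ne {a b : V} {l : List (QuiverArrow V)} (h : source l b ≠ a) :
    ghostPath K l b * vertex K a = 0 := by
  rw [← ghostPath_mul_source, mul_assoc, vertex_mul_of_ne h, mul_zero]

theorem path_mul_vertex (l : List (QuiverArrow V)) (b : V) :
    path K l b * vertex K b = path K l b := by
  induction l with
  | nil => simp
  | cons e l ih => rw [path_cons, mul_assoc, ih]

theorem vertex_mul_ghostPath (l : List (QuiverArrow V)) (b : V) :
    vertex K b * ghostPath K l b = ghostPath K l b := by
  induction l with
  | nil => simp
  | cons e l ih => rw [ghostPath_cons, ← mul_assoc, ih]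

theorem path_append (l m : List (QuiverArrow V)) (b : V) :
    path K (l ++ m) b = path K l (source m b) * path K m b := by
  induction l with
  | nil => simp [source_mul_path]
  | cons e l ih => rw [List.cons_append, path_cons, path_cons, ih, mul_assoc]

theorem ghostPath_append (l m : List (QuiverArrow V)) (b : V) :
    ghostPath K (l ++ m) b = ghostPath K m b * ghostPath K l (source m b) := by
  induction l with
  | nil => simp [ghostPath_mul_source]
  | cons e l ih => rw [List.cons_append, ghostPath_cons, ghostPath_cons, ih, mul_assoc]

theorem path_eq_zero {l : List (QuiverArrow V)} {b : V} (h : ¬ IsPath l b) : path K l b = 0 := by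
  induction l with
  | nil => simp at h
  | cons e l ih =>
    rw [path_cons]
    by_cases hl : IsPath l b
    · have he : e.r ≠ source l b := fun he => h ⟨he, hl⟩
      rw [← source_mul_path, ← mul_assoc, arrow_mul_vertex_of_ne he, zero_mul]
    · rw [ih hl, mul_zero]

theorem ghostPath_eq_zero {l : List (QuiverArrow V)} {b : V} (h : ¬ IsPath l b) :
    ghostPath K l b = 0 := by
  induction l with
  | nil => simp at h
  | cons e l ih =>
    rw [ghostPath_cons]
    by_cases hl : IsPath l b
    · have he : source l b ≠ e.r := fun he => h ⟨he.symm, hl⟩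
      rw [← ghostPath_mul_source, mul_assoc, vertex_mul_ghost_of_ne he, mul_zero]
    · rw [ih hl, zero_mul]

theorem ghostPath_mul_path_self {l : List (QuiverArrow V)} {b : V} (h : IsPath l b) :
    ghostPath K l b * path K l b = vertex K b := by
  induction l with
  | nil => simp
  | cons e l ih =>
    rw [isPath_cons] at h
    rw [ghostPath_cons, path_cons, mul_assoc, ← mul_assoc (ghost K e), ghost_mul_arrow_self, h.1,
      source_mul_path, ih h.2]

/-- The Leavitt path algebra is spanned by the elements `p q*`, for paths `p` and `q` with the
same range. -/
theorem span_path_mul_ghostPath : Submodule.span K {x : LeavittPathAlgebra K V |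
    ∃ l m b, IsPath l b ∧ IsPath m b ∧ x = path K l b * ghostPath K m b} = ⊤ := by
  set S := Submodule.span K {x : LeavittPathAlgebra K V |
    ∃ l m b, IsPath l b ∧ IsPath m b ∧ x = path K l b * ghostPath K m b} with hS
  -- Lists that are not paths give zero, so the path conditions can be ignored from here on.
  have mem (l m : List (QuiverArrow V)) (b : V) : path K l b * ghostPath K m b ∈ S := by
    by_cases hl : IsPath l b
    · by_cases hm : IsPath m b
      · exact Submodule.subset_span ⟨l, m, b, hl, hm, rfl⟩
      · simp [ghostPath_eq_zero hm]
    · simp [path_eq_zero hl]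
  rw [eq_top_iff]
  rintro x -
  induction x using induction_words with
  | zero => exact S.zero_mem
  | add x y hx hy => exact S.add_mem hx hy
  | smul k x hx => exact S.smul_mem k hx
  | base g =>
    cases g with
    | vertex a => simpa using! mem [] [] a
    | arrow e => simpa [path_cons, mul_assoc, arrow_mul_range] using! mem [e] [] e.r
    | ghost e =>
      simpa [ghostPath_cons, ← mul_assoc, range_mul_ghost] using! mem [] [e] e.r
  | gen_mul g x hx =>
    refine Submodule.span_induction ?_ ?_ ?_ ?_ hx
    · rintro _ ⟨l, m, b, hl, -, rfl⟩
      rw [← mul_assoc]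
      cases g with
      | vertex a =>
        change vertex K a * _ * _ ∈ S
        rcases eq_or_ne a (source l b) with rfl | h
        · rw [source_mul_path]
          exact mem l m b
        · simp [vertex_mul_path_of_ne h]
      | arrow e => exact mem (e :: l) m b
      | ghost e =>
        change ghost K e * _ * _ ∈ S
        cases l with
        | nil =>
          rcases eq_or_ne e.s b with rfl | h
          -- With no arrow to cancel, `e*` is absorbed on the ghost side: `e* m* = (m e)*`.
          · have := mem [] (m ++ [e]) e.r
            rw [ghostPath_append] at this
            simpa [ghostPath_cons, range_mul_ghost, ghost_mul_source, ← mul_assoc] using this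
          · simp [ghost_mul_vertex_of_ne h]
        | cons f l =>
          rw [path_cons, ← mul_assoc]
          rcases eq_or_ne e f with rfl | h
          · rw [isPath_cons] at hl
            rw [ghost_mul_arrow_self, hl.1, source_mul_path]
            exact mem l m b
          · simp [ghost_mul_arrow_of_ne h]
    · simp
    · intro x y _ _ hx hy
      rw [mul_add]
      exact S.add_mem hx hy
    · intro k x _ hx
      rw [mul_smul_comm]
      exact S.smul_mem k hx

end PathElements

end LeavittPathAlgebra

/-! ### Branching systems and representations over Laurent polynomials -/

open QuiverArrow

/-- A system of injections of a set `κ` into itself, one for each arrow, such that the images of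
the arrows with a given source form a partition of `κ`. -/
structure BranchingSystem (V : Type u) [Quiver.{v} V] (κ : Type*) where
  /-- The injection that belongs to an arrow. -/
  map : QuiverArrow V → κ → κ
  map_inj : ∀ {e f : QuiverArrow V} {j k : κ}, e.s = f.s → map e j = map f k → e = f ∧ j = k
  exists_map_eq : ∀ (e : QuiverArrow V) (k : κ), ∃ f j, f.s = e.s ∧ map f j = k

namespace BranchingSystem

variable {V : Type u} [Quiver.{v} V] {κ : Type*}

/-- There is a branching system that takes finitely many prescribed values. -/
theorem exists_prescribed {n : ℕ} (d : Fin n → QuiverArrow V × (QuiverArrow V ⊕ ℕ))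
    (val : Fin n → QuiverArrow V ⊕ ℕ) (hd : d.Injective) (hval : val.Injective) :
    ∃ S : BranchingSystem V (QuiverArrow V ⊕ ℕ), ∀ i, S.map (d i).1 (d i).2 = val i := by
  -- The arrows at one vertex amount to a bijection `Star a × κ ≃ κ`. The choice of `κ` makes it
  -- infinite and at least as large as every star, so such bijections exist and a finite partial
  -- injection extends to one.
  have key (a : V) (ha : Nonempty (Quiver.Star a)) :
      ∃ g : (Quiver.Star a × (QuiverArrow V ⊕ ℕ)) ≃ (QuiverArrow V ⊕ ℕ),
        ∀ x i, d i = (⟨a, x.1⟩, x.2) → g x = val i := by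
    let s : Set (Quiver.Star a × (QuiverArrow V ⊕ ℕ)) := {x | ∃ i, d i = (⟨a, x.1⟩, x.2)}
    have hs (x : s) : ∃ i, d i = (⟨a, x.1.1⟩, x.1.2) := x.2
    choose idx hidx using hs
    have hinj : Function.Injective idx := by
      intro x y hxy
      have h := (hidx x).symm.trans ((congrArg d hxy).trans (hidx y))
      rw [Prod.mk.injEq, Sigma.mk.injEq] at h
      exact Subtype.ext (Prod.ext (eq_of_heq h.1.2) h.2)
    have hfin : Finite s := Finite.of_injective idx hinj
    have hcard : Nonempty ((Quiver.Star a × (QuiverArrow V ⊕ ℕ)) ≃ (QuiverArrow V ⊕ ℕ)) := by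
      rw [← Cardinal.eq, Cardinal.mk_prod, Cardinal.lift_id, Cardinal.lift_id]
      refine Cardinal.mul_eq_right (Cardinal.aleph0_le_mk _) ?_ (Cardinal.mk_ne_zero _)
      refine Cardinal.mk_le_of_injective
        (f := fun e : Quiver.Star a => Sum.inl (⟨a, e⟩ : QuiverArrow V)) fun e f h => ?_
      simpa using h
    obtain ⟨g, hg⟩ := Cardinal.extend_function_of_lt
      (⟨fun x => val (idx x), hval.comp hinj⟩ : s ↪ (QuiverArrow V ⊕ ℕ))
      ((Cardinal.lt_aleph0_of_finite s).trans_le (Cardinal.aleph0_le_mk _)) hcard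
    refine ⟨g, fun x i hi => ?_⟩
    have := hg ⟨x, i, hi⟩
    rw [this]
    exact congrArg val (hd ((hidx ⟨x, i, hi⟩).trans hi.symm))
  choose g hg using key
  refine ⟨⟨fun e k => g e.s ⟨e.2⟩ (e.2, k), ?_, ?_⟩, ?_⟩
  · rintro ⟨a, e⟩ ⟨b, f⟩ j k h h'
    obtain rfl : a = b := h
    have := (g a ⟨e⟩).injective h'
    simpa using this
  · rintro ⟨a, e⟩ k
    refine ⟨⟨a, ((g a ⟨e⟩).symm k).1⟩, ((g a ⟨e⟩).symm k).2, rfl, ?_⟩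
    exact (g a ⟨e⟩).apply_symm_apply k
  · intro i
    exact hg _ _ _ i rfl

variable (S : BranchingSystem V κ)

/-- The action of a list of arrows. -/
def act (l : List (QuiverArrow V)) (k : κ) : κ := l.foldr S.map k

/-- Every closed path fixes a point of some branching system. -/
theorem exists_act_eq (l : List (QuiverArrow V)) (hl : l ≠ []) :
    ∃ (S : BranchingSystem V (QuiverArrow V ⊕ ℕ)) (k : QuiverArrow V ⊕ ℕ), S.act l k = k := by
  have hpos : 0 < l.length := List.length_pos_iff.2 hl
  -- The `i`-th arrow is to send the point `i + 1`, modulo the length, to `i`. A repeated arrow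
  -- causes no conflict because these points are distinct.
  obtain ⟨S, hS⟩ := exists_prescribed
    (fun i : Fin l.length => (l[i], Sum.inr ((i + 1 : ℕ) % l.length)))
    (fun i => Sum.inr (i : ℕ))
    (by
      intro i j h
      simp only [Prod.mk.injEq, Sum.inr.injEq] at h
      have h' : (i : ℕ) ≡ j [MOD l.length] := Nat.ModEq.add_right_cancel' 1 h.2
      exact Fin.ext (Nat.ModEq.eq_of_lt_of_lt h' i.2 j.2))
    (by
      intro i j h
      simpa [Fin.ext_iff] using h)
  refine ⟨S, Sum.inr 0, ?_⟩
  -- Downward induction: the part of the path from position `i` on carries `0` to `i`, which is read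
  -- modulo the length only to cover the starting case.
  have key (i : ℕ) (hi : i ≤ l.length) :
      S.act (l.drop i) (Sum.inr 0) = Sum.inr (i % l.length) := by
    induction hi using Nat.decreasingInduction with
    | self => simp [act]
    | of_succ i hi ih =>
      rw [List.drop_eq_getElem_cons hi]
      change S.map _ (S.act _ _) = _
      rw [ih, Nat.mod_eq_of_lt hi]
      exact hS ⟨i, hi⟩
  simpa using key 0 (Nat.zero_le _)

section Representation

variable (K : Type w) [Field K]

/-- The free module on which the Leavitt path algebra acts. -/
abbrev Carrier (K : Type w) [Field K] (V : Type u) (κ : Type*) :=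
  (V × κ) →₀ LaurentPolynomial K

open LaurentPolynomial Classical in
/-- The action of the generators. -/
noncomputable def genEnd : LeavittGen V → Module.End (LaurentPolynomial K) (Carrier K V κ)
  | .vertex a => Finsupp.linearCombination _ fun x => if x.1 = a then Finsupp.single x 1 else 0
  | .arrow e => Finsupp.linearCombination _ fun x =>
      if x.1 = e.r then Finsupp.single (e.s, S.map e x.2) (T 1) else 0
  | .ghost e => Finsupp.linearCombination _ fun x =>
      if h : x.1 = e.s ∧ ∃ j, S.map e j = x.2 then Finsupp.single (e.r, h.2.choose) (T (-1))
      else 0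

open LaurentPolynomial

variable {K}

theorem genEnd_vertex_single (a : V) (k : κ) (r : LaurentPolynomial K) :
    S.genEnd K (.vertex a) (Finsupp.single (a, k) r) = Finsupp.single (a, k) r := by
  simp [genEnd]

theorem genEnd_vertex_single_of_ne {a b : V} (h : b ≠ a) (k : κ) (r : LaurentPolynomial K) :
    S.genEnd K (.vertex a) (Finsupp.single (b, k) r) = 0 := by
  simp [genEnd, h]

theorem genEnd_arrow_single (e : QuiverArrow V) (k : κ) (r : LaurentPolynomial K) :
    S.genEnd K (.arrow e) (Finsupp.single (e.r, k) r) =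
      Finsupp.single (e.s, S.map e k) (r * T 1) := by
  simp [genEnd]

theorem genEnd_arrow_single_of_ne {e : QuiverArrow V} {b : V} (h : b ≠ e.r) (k : κ)
    (r : LaurentPolynomial K) : S.genEnd K (.arrow e) (Finsupp.single (b, k) r) = 0 := by
  simp [genEnd, h]

theorem genEnd_ghost_single (e : QuiverArrow V) (k : κ) (r : LaurentPolynomial K) :
    S.genEnd K (.ghost e) (Finsupp.single (e.s, S.map e k) r) =
      Finsupp.single (e.r, k) (r * T (-1)) := by
  have h : ∃ j, S.map e j = S.map e k := ⟨k, rfl⟩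
  simp [genEnd, (S.map_inj rfl h.choose_spec).2]

theorem genEnd_ghost_single_of_ne {e : QuiverArrow V} {b : V} (h : b ≠ e.s) (k : κ)
    (r : LaurentPolynomial K) : S.genEnd K (.ghost e) (Finsupp.single (b, k) r) = 0 := by
  simp [genEnd, h]

theorem genEnd_ghost_single_map_of_ne {e f : QuiverArrow V} (h : e ≠ f) (b : V) (hb : f.s = b)
    (k : κ) (r : LaurentPolynomial K) :
    S.genEnd K (.ghost e) (Finsupp.single (b, S.map f k) r) = 0 := by
  have h' : ¬ (b = e.s ∧ ∃ j, S.map e j = S.map f k) := by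
    rintro ⟨rfl, j, hj⟩
    exact h (S.map_inj hb.symm hj).1
  simp only [genEnd, Finsupp.linearCombination_single, dif_neg h', smul_zero]

/-- Relation (4) rests on injectivity and disjointness of the images, relation (5) on their covering
`κ`; the weights `T` and `T⁻¹` cancel in both. -/
theorem genEnd_rel (x y : LeavittFree K V) (h : LeavittRel K x y) :
    LeavittPathAlgebra.freeLift (S.genEnd K) x = LeavittPathAlgebra.freeLift (S.genEnd K) y := by
  obtain a | ⟨a, b, h⟩ | e | e | e | e | e | ⟨e, f, h⟩ | @⟨a, _, _⟩ := h <;>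
    refine Finsupp.lhom_ext fun ⟨c, k⟩ r => ?_ <;>
    simp only [map_mul, map_zero, map_sum, LeavittPathAlgebra.freeLift_gen, Module.End.mul_apply,
      LinearMap.zero_apply, LinearMap.sum_apply]
  · rcases eq_or_ne c a with rfl | hc
    · simp [genEnd_vertex_single]
    · simp [genEnd_vertex_single_of_ne S hc]
  · rcases eq_or_ne c b with rfl | hc
    · rw [genEnd_vertex_single, genEnd_vertex_single_of_ne S h.symm]
    · simp [genEnd_vertex_single_of_ne S hc]
  · rcases eq_or_ne c e.r with rfl | hc
    · rw [genEnd_arrow_single, genEnd_vertex_single]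
    · simp [genEnd_arrow_single_of_ne S hc]
  · rcases eq_or_ne c e.r with rfl | hc
    · simp [genEnd_vertex_single, genEnd_arrow_single]
    · simp [genEnd_arrow_single_of_ne S hc, genEnd_vertex_single_of_ne S hc]
  · rcases eq_or_ne c e.s with rfl | hc
    · obtain ⟨f, j, hf, rfl⟩ := S.exists_map_eq e k
      rcases eq_or_ne e f with rfl | hef
      · rw [genEnd_ghost_single, genEnd_vertex_single]
      · simp [genEnd_ghost_single_map_of_ne S hef _ hf]
    · simp [genEnd_ghost_single_of_ne S hc]
  · rcases eq_or_ne c e.s with rfl | hc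
    · simp [genEnd_vertex_single]
    · simp [genEnd_ghost_single_of_ne S hc, genEnd_vertex_single_of_ne S hc]
  · rcases eq_or_ne c e.r with rfl | hc
    · rw [genEnd_arrow_single, genEnd_ghost_single, genEnd_vertex_single, mul_assoc, ← T_add]
      simp
    · simp [genEnd_arrow_single_of_ne S hc, genEnd_vertex_single_of_ne S hc]
  · rcases eq_or_ne c f.r with rfl | hc
    · by_cases hs : f.s = e.s
      · rw [genEnd_arrow_single, genEnd_ghost_single_map_of_ne S h _ rfl]
      · rw [genEnd_arrow_single, genEnd_ghost_single_of_ne S hs]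
    · simp [genEnd_arrow_single_of_ne S hc]
  · rcases eq_or_ne c a with rfl | hc
    · obtain ⟨e⟩ := ‹Nonempty (Quiver.Star c)›
      -- Every point lies in the image of exactly one arrow at `c`, so one summand survives.
      obtain ⟨⟨c', f⟩, j, hf, rfl⟩ := S.exists_map_eq ⟨c, e⟩ k
      obtain rfl : c' = c := hf
      rw [genEnd_vertex_single, Finset.sum_eq_single (f : Quiver.Star c')]
      · rw [genEnd_ghost_single S ⟨c', f⟩, genEnd_arrow_single S ⟨c', f⟩, mul_assoc, ← T_add]
        simp
      · intro f' _ hf'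
        rw [genEnd_ghost_single_map_of_ne S (e := ⟨c', f'⟩) (f := ⟨c', f⟩) _ _ rfl, map_zero]
        simpa using hf'
      · simp
    · rw [genEnd_vertex_single_of_ne S hc]
      refine (Finset.sum_eq_zero fun f _ => ?_).symm
      rw [genEnd_ghost_single_of_ne S (e := ⟨a, f⟩) hc, map_zero]

variable (K) in
/-- The representation of the Leavitt path algebra that belongs to a branching system. -/
noncomputable def rep :
    LeavittPathAlgebra K V →ₙₐ[K] Module.End (LaurentPolynomial K) (Carrier K V κ) :=
  LeavittPathAlgebra.lift (S.genEnd K) S.genEnd_rel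

theorem rep_vertex_single (a : V) (k : κ) (r : LaurentPolynomial K) :
    S.rep K (LeavittPathAlgebra.vertex K a) (Finsupp.single (a, k) r) =
      Finsupp.single (a, k) r := by
  rw [rep, LeavittPathAlgebra.vertex, LeavittPathAlgebra.lift_gen, genEnd_vertex_single]

theorem rep_vertex_single_of_ne {a b : V} (h : b ≠ a) (k : κ) (r : LaurentPolynomial K) :
    S.rep K (LeavittPathAlgebra.vertex K a) (Finsupp.single (b, k) r) = 0 := by
  rw [rep, LeavittPathAlgebra.vertex, LeavittPathAlgebra.lift_gen, genEnd_vertex_single_of_ne S h]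

/-- Each arrow contributes a factor `T`; hence a closed path acts on the basis vector of a fixed
point as a power of `T`. -/
theorem rep_path_single {l : List (QuiverArrow V)} {b : V} (hl : IsPath l b) (k : κ)
    (r : LaurentPolynomial K) :
    S.rep K (LeavittPathAlgebra.path K l b) (Finsupp.single (b, k) r) =
      Finsupp.single (source l b, S.act l k) (r * T l.length) := by
  induction l with
  | nil => simp [rep_vertex_single, act]
  | cons e l ih =>
    rw [isPath_cons] at hl
    rw [LeavittPathAlgebra.path_cons, map_mul, Module.End.mul_apply, ih hl.2, ← hl.1, rep,
      LeavittPathAlgebra.arrow, LeavittPathAlgebra.lift_gen, genEnd_arrow_single, mul_assoc,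
      ← T_add]
    simp [act]

theorem rep_path_single_of_ne (l : List (QuiverArrow V)) {a b : V} (h : a ≠ b) (k : κ)
    (r : LaurentPolynomial K) :
    S.rep K (LeavittPathAlgebra.path K l b) (Finsupp.single (a, k) r) = 0 := by
  rw [← LeavittPathAlgebra.path_mul_vertex, map_mul, Module.End.mul_apply,
    rep_vertex_single_of_ne S h, map_zero]

end Representation

end BranchingSystem

/-! ### Closed paths exclude regularity and the artinian property -/

namespace LeavittPathAlgebra

variable {K : Type w} [Field K] {V : Type u} [Quiver.{v} V]

theorem vertex_ne_zero (a : V) : vertex K a ≠ 0 := by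
  intro h
  obtain ⟨S, -⟩ := BranchingSystem.exists_prescribed (V := V) (n := 0) Fin.elim0 Fin.elim0
    (fun i => i.elim0) (fun i => i.elim0)
  have := S.rep_vertex_single (K := K) a (Sum.inr 0) 1
  rw [h, map_zero, LinearMap.zero_apply, eq_comm, Finsupp.single_eq_zero] at this
  exact one_ne_zero this

open LaurentPolynomial

/-- Evaluation at `T = 1` kills the left side. -/
theorem one_sub_T_mul_ne_one {n : ℕ} (y : LaurentPolynomial K) : (1 - T n) * y ≠ 1 := by
  intro h
  have := congrArg (LaurentPolynomial.eval₂ (RingHom.id K) 1) h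
  rw [map_mul, map_sub, map_one, eval₂_T_n] at this
  simp at this

theorem one_sub_T_ne_zero {n : ℕ} (hn : n ≠ 0) : (1 - T n : LaurentPolynomial K) ≠ 0 := by
  rw [sub_ne_zero, ← T_zero]
  intro h
  have := congrArg (fun p : LaurentPolynomial K => p.coeff 0) h
  simp only [T_apply] at this
  simp [hn] at this

/-- If `x = v - c` had a generalized inverse, a basis vector `ξ` fixed up to a power of `T` by `c`
would lie in the image of `x`. The sum of coordinates maps that image into multiples of `1 - T^n`,
but maps `ξ` to `1`. -/
theorem not_quiverReach_self_of_isVonNeumannRegular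
    (h : IsVonNeumannRegular (LeavittPathAlgebra K V)) (a : V) : ¬ QuiverReach a a := by
  intro ha
  obtain ⟨l, hne, hl, hs⟩ := ha.exists_isPath
  obtain ⟨S, k, hk⟩ := BranchingSystem.exists_act_eq l hne
  obtain ⟨b, hb⟩ := h (vertex K a - path K l a)
  set x := vertex K a - path K l a with hx
  set ξ : BranchingSystem.Carrier K V (QuiverArrow V ⊕ ℕ) := Finsupp.single (a, k) 1 with hξ
  have hxξ : S.rep K x ξ = (1 - T l.length : LaurentPolynomial K) • ξ := by
    rw [hx, map_sub, LinearMap.sub_apply, S.rep_vertex_single, S.rep_path_single hl, hs, hk,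
      sub_smul, one_smul, hξ]
    simp
  -- Apply `x b x = x` to `ξ` and cancel the nonzero factor `1 - T^n`, the module being
  -- torsion-free.
  have hξ' : S.rep K x (S.rep K b ξ) = ξ := by
    have h1 : S.rep K (x * b * x) ξ = S.rep K x ξ := by rw [hb]
    rw [map_mul, map_mul, Module.End.mul_apply, Module.End.mul_apply, hxξ, map_smul, map_smul] at h1
    exact smul_right_injective _ (one_sub_T_ne_zero (by simpa using hne)) h1
  let σ : BranchingSystem.Carrier K V (QuiverArrow V ⊕ ℕ) →ₗ[LaurentPolynomial K]
    LaurentPolynomial K := Finsupp.linearCombination _ fun _ => 1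
  -- The coordinate sum forgets where `c` moves a basis vector and retains only the factor `T^n`.
  have hσ : σ ∘ₗ S.rep K x = (1 - T l.length : LaurentPolynomial K) •
      (σ ∘ₗ S.rep K (vertex K a)) := by
    refine Finsupp.lhom_ext fun ⟨c, j⟩ r => ?_
    rw [hx, map_sub, LinearMap.comp_apply, LinearMap.smul_apply, LinearMap.comp_apply,
      LinearMap.sub_apply]
    rcases eq_or_ne c a with rfl | hc
    · rw [S.rep_vertex_single, S.rep_path_single hl]
      simp only [σ, map_sub, Finsupp.linearCombination_single, smul_eq_mul]
      ring
    · rw [S.rep_vertex_single_of_ne hc, S.rep_path_single_of_ne _ hc]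
      simp
  have h2 := congrArg σ hξ'
  rw [← LinearMap.comp_apply, hσ, LinearMap.smul_apply, smul_eq_mul] at h2
  refine one_sub_T_mul_ne_one _ (h2.trans ?_)
  simp [σ, hξ]

/-- The products `v (v - c)ⁿ` for `c = path K l a` and `v = vertex K a`. -/
noncomputable def vertexSubPathPow (K : Type w) [Field K] (l : List (QuiverArrow V)) (a : V) :
    ℕ → LeavittPathAlgebra K V
  | 0 => vertex K a
  | n + 1 => vertexSubPathPow K l a n * (vertex K a - path K l a)

/-- The elements that send `ξ` to a multiple of `(1 - T^k)^n`, with `k` the length of the closed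
path, form left ideals because the action is linear over Laurent polynomials. They decrease strictly
in `n`, as `v (v - c)^n` witnesses. -/
theorem not_quiverReach_self_of_isLeftArtinian
    (h : IsLeftArtinian (LeavittPathAlgebra K V)) (a : V) : ¬ QuiverReach a a := by
  intro ha
  obtain ⟨l, hne, hl, hs⟩ := ha.exists_isPath
  obtain ⟨S, k, hk⟩ := BranchingSystem.exists_act_eq l hne
  set ξ : BranchingSystem.Carrier K V (QuiverArrow V ⊕ ℕ) := Finsupp.single (a, k) 1 with hξ
  have hpow (n : ℕ) : S.rep K (vertexSubPathPow K l a n) ξ =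
      (1 - T l.length : LaurentPolynomial K) ^ n • ξ := by
    induction n with
    | zero => simp [vertexSubPathPow, hξ, S.rep_vertex_single]
    | succ n ih =>
      rw [vertexSubPathPow, map_mul, Module.End.mul_apply, map_sub, LinearMap.sub_apply,
        S.rep_vertex_single, S.rep_path_single hl, hs, hk, pow_succ', mul_smul, ← ih, ← map_smul]
      congr 1
      simp [hξ, sub_smul]
  let J (n : ℕ) : NonUnitalLeftIdeal (LeavittPathAlgebra K V) :=
    { carrier := {x | ∃ y, S.rep K x ξ = (1 - T l.length : LaurentPolynomial K) ^ n • y}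
      zero_mem' := ⟨0, by simp⟩
      add_mem' := by
        rintro x x' ⟨y, hy⟩ ⟨y', hy'⟩
        exact ⟨y + y', by rw [map_add, LinearMap.add_apply, hy, hy', smul_add]⟩
      neg_mem' := by
        rintro x ⟨y, hy⟩
        exact ⟨-y, by rw [map_neg, LinearMap.neg_apply, hy, smul_neg]⟩
      mul_mem_left := by
        rintro r x ⟨y, hy⟩
        exact ⟨S.rep K r y, by rw [map_mul, Module.End.mul_apply, hy, map_smul]⟩ }
  have hJ : StrictAnti J := by
    refine strictAnti_nat_of_succ_lt fun n => lt_of_le_not_ge ?_ fun hle => ?_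
    · rintro x ⟨y, hy⟩
      exact ⟨(1 - T l.length : LaurentPolynomial K) • y, by rw [hy, pow_succ, mul_smul]⟩
    · obtain ⟨y, hy⟩ := hle (⟨ξ, hpow n⟩ : vertexSubPathPow K l a n ∈ (J n).carrier)
      rw [hpow, pow_succ, mul_smul] at hy
      have h1 := smul_right_injective _
        (pow_ne_zero n (one_sub_T_ne_zero (K := K) (by simpa using hne))) hy
      have h2 := DFunLike.congr_fun h1 (a, k)
      rw [hξ, Finsupp.single_eq_same, Finsupp.smul_apply, smul_eq_mul] at h2
      exact one_sub_T_mul_ne_one _ h2.symm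
  have : WellFoundedLT (NonUnitalLeftIdeal (LeavittPathAlgebra K V)) := h
  exact (not_strictAnti_of_wellFoundedLT J) hJ

end LeavittPathAlgebra

/-! ### Orthogonal families violate both chain conditions -/

section OrthogonalSequences

variable {R : Type u} [NonUnitalRing R]

/-- The left annihilators of the tails `e n, e (n + 1), …` increase strictly: `e n` kills the later
terms but not itself. -/
theorem not_isLeftNoetherian_of_orthogonal {e : ℕ → R} (he : ∀ i, e i * e i ≠ 0)
    (ho : ∀ i j, i ≠ j → e i * e j = 0) : ¬ IsLeftNoetherian R := by
  intro h
  let J (n : ℕ) : NonUnitalLeftIdeal R :=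
    { carrier := {x | ∀ i, n ≤ i → x * e i = 0}
      zero_mem' := fun i _ => zero_mul _
      add_mem' := fun hx hy i hi => by rw [add_mul, hx i hi, hy i hi, add_zero]
      neg_mem' := fun hx i hi => by rw [neg_mul, hx i hi, neg_zero]
      mul_mem_left := fun r x hx i hi => by rw [mul_assoc, hx i hi, mul_zero] }
  have hJ : StrictMono J := by
    refine strictMono_nat_of_lt_succ fun n => lt_of_le_not_ge ?_ fun hle => ?_
    · exact fun x hx i hi => hx i (Nat.le_of_succ_le hi)
    · exact he n (hle (fun i hi => ho n i (by lia) : e n ∈ (J (n + 1)).carrier) n le_rfl)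
  have : WellFoundedGT (NonUnitalLeftIdeal R) := h
  exact not_strictMono_of_wellFoundedGT J hJ

/-- The left annihilators of the initial segments decrease strictly, again because of `e n`. -/
theorem not_isLeftArtinian_of_orthogonal {e : ℕ → R} (he : ∀ i, e i * e i ≠ 0)
    (ho : ∀ i j, i ≠ j → e i * e j = 0) : ¬ IsLeftArtinian R := by
  intro h
  let J (n : ℕ) : NonUnitalLeftIdeal R :=
    { carrier := {x | ∀ i, i < n → x * e i = 0}
      zero_mem' := fun i _ => zero_mul _
      add_mem' := fun hx hy i hi => by rw [add_mul, hx i hi, hy i hi, add_zero]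
      neg_mem' := fun hx i hi => by rw [neg_mul, hx i hi, neg_zero]
      mul_mem_left := fun r x hx i hi => by rw [mul_assoc, hx i hi, mul_zero] }
  have hJ : StrictAnti J := by
    refine strictAnti_nat_of_succ_lt fun n => lt_of_le_not_ge ?_ fun hle => ?_
    · exact fun x hx i hi => hx i (Nat.lt_succ_of_lt hi)
    · exact he n (hle (fun i hi => ho n i (by lia) : e n ∈ (J n).carrier) n n.lt_succ_self)
  have : WellFoundedLT (NonUnitalLeftIdeal R) := h
  exact not_strictAnti_of_wellFoundedLT J hJ

end OrthogonalSequences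

namespace LeavittPathAlgebra

open QuiverArrow

variable {K : Type w} [Field K] {V : Type u} [Quiver.{v} V]

theorem not_chain_conditions_of_orthogonal {x y : ℕ → LeavittPathAlgebra K V} {b : ℕ → V}
    (hself : ∀ i, y i * x i = vertex K (b i)) (ho : ∀ i j, i ≠ j → y i * x j = 0) :
    ¬ IsLeftNoetherian (LeavittPathAlgebra K V) ∧ ¬ IsLeftArtinian (LeavittPathAlgebra K V) := by
  -- Sandwiching the square between `y i` and `x i` gives `(y i * x i)³`, a vertex.
  have he (i : ℕ) : (x i * y i) * (x i * y i) ≠ 0 := by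
    intro h
    have h' : (y i * x i) * (y i * x i) * (y i * x i) = 0 := by
      calc _ = y i * ((x i * y i) * (x i * y i)) * x i := by simp only [mul_assoc]
        _ = 0 := by rw [h, mul_zero, zero_mul]
    rw [hself, vertex_mul_self, vertex_mul_self] at h'
    exact vertex_ne_zero _ h'
  have ho' (i j : ℕ) (hij : i ≠ j) : (x i * y i) * (x j * y j) = 0 := by
    rw [mul_assoc, ← mul_assoc (y i), ho i j hij, zero_mul, mul_zero]
  exact ⟨not_isLeftNoetherian_of_orthogonal he ho', not_isLeftArtinian_of_orthogonal he ho'⟩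

theorem not_chain_conditions_of_infinite (h : Infinite V) :
    ¬ IsLeftNoetherian (LeavittPathAlgebra K V) ∧ ¬ IsLeftArtinian (LeavittPathAlgebra K V) := by
  let b := Infinite.natEmbedding V
  exact not_chain_conditions_of_orthogonal (x := fun i => vertex K (b i))
    (y := fun i => vertex K (b i)) (fun i => vertex_mul_self (b i))
    fun i j hij => vertex_mul_of_ne (b.injective.ne hij)

theorem not_chain_conditions_of_infinite_star {a : V} (h : Infinite (Quiver.Star a)) :
    ¬ IsLeftNoetherian (LeavittPathAlgebra K V) ∧ ¬ IsLeftArtinian (LeavittPathAlgebra K V) := by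
  let f := Infinite.natEmbedding (Quiver.Star a)
  refine not_chain_conditions_of_orthogonal (x := fun i => arrow K ⟨a, f i⟩)
    (y := fun i => ghost K ⟨a, f i⟩) (fun i => ghost_mul_arrow_self ⟨a, f i⟩)
    fun i j hij => ghost_mul_arrow_of_ne fun hf => hij (f.injective ?_)
  simpa using hf

/-- Let `c` be a closed path at `a` with first arrow `e`, and `f ≠ e` another arrow at `a`. Then `f*
c = 0` and `c* c = a`, so the elements `cⁿ f` and `f* c*ⁿ` form an orthogonal family. -/
theorem not_chain_conditions_of_exit {a : V} (ha : QuiverReach a a)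
    (h : ¬ Subsingleton (Quiver.Star a)) :
    ¬ IsLeftNoetherian (LeavittPathAlgebra K V) ∧ ¬ IsLeftArtinian (LeavittPathAlgebra K V) := by
  obtain ⟨l, hne, hl, hs⟩ := ha.exists_isPath
  obtain ⟨e, l, rfl⟩ := List.exists_cons_of_ne_nil hne
  obtain ⟨f, hfs, hfe⟩ : ∃ f : QuiverArrow V, f.s = a ∧ f ≠ e := by
    by_contra! H
    refine h ⟨fun f g => ?_⟩
    have := (H ⟨a, f⟩ rfl).trans (H ⟨a, g⟩ rfl).symm
    simpa using this
  set c := path K (e :: l) a with hc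
  set c' := ghostPath K (e :: l) a with hc'
  let x (n : ℕ) : LeavittPathAlgebra K V := (fun z => c * z)^[n] (arrow K f)
  let y (n : ℕ) : LeavittPathAlgebra K V := (fun z => z * c')^[n] (ghost K f)
  have x_succ (n : ℕ) : x (n + 1) = c * x n := Function.iterate_succ_apply' _ _ _
  have y_succ (n : ℕ) : y (n + 1) = y n * c' := Function.iterate_succ_apply' _ _ _
  have hcc : c' * c = vertex K a := ghostPath_mul_path_self hl
  have hx (n : ℕ) : vertex K a * x n = x n := by
    cases n with
    | zero =>
      change vertex K a * arrow K f = arrow K f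
      rw [← hfs, source_mul_arrow]
    | succ n =>
      have : vertex K a * c = c := by rw [hc]; nth_rw 1 [← hs]; exact source_mul_path _ _
      rw [x_succ, ← mul_assoc, this]
  have step (i j : ℕ) : y (i + 1) * x (j + 1) = y i * x j := by
    rw [x_succ, y_succ, mul_assoc, ← mul_assoc c', hcc, hx]
  have h0 (j : ℕ) : y 0 * x (j + 1) = 0 := by
    rw [x_succ, ← mul_assoc, hc, path_cons, ← mul_assoc]
    change ghost K f * _ * _ * _ = 0
    rw [ghost_mul_arrow_of_ne hfe, zero_mul, zero_mul]
  have h0' (i : ℕ) : y (i + 1) * x 0 = 0 := by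
    rw [y_succ, mul_assoc, hc', ghostPath_cons, mul_assoc]
    change _ * (_ * (_ * arrow K f)) = 0
    rw [ghost_mul_arrow_of_ne hfe.symm, mul_zero, mul_zero]
  refine not_chain_conditions_of_orthogonal (x := x) (y := y) (b := fun _ => f.r)
    (fun i => ?_) fun i j hij => ?_
  · induction i with
    | zero => exact ghost_mul_arrow_self f
    | succ i ih => rw [step, ih]
  · induction i generalizing j with
    | zero =>
      obtain ⟨j, rfl⟩ := Nat.exists_eq_succ_of_ne_zero hij.symm
      exact h0 j
    | succ i ih =>
      cases j with
      | zero => exact h0' i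
      | succ j => rw [step, ih j (by lia)]

end LeavittPathAlgebra

/-! ### Matrix units and acyclic quivers -/

/-- Square matrices over a field have generalized inverses. -/
theorem Matrix.exists_mul_mul_self {K n : Type*} [Field K] [Fintype n] (A : Matrix n n K) :
    ∃ B : Matrix n n K, A * B * A = A := by
  classical
  let f := Matrix.toLin' A
  -- The inverse is a section `g` of `f` onto its range, preceded by a projection `p` onto that
  -- range.
  obtain ⟨g, hg⟩ := f.rangeRestrict.exists_rightInverse_of_surjective f.range_rangeRestrict
  obtain ⟨p, hp⟩ := (LinearMap.range f).subtype.exists_leftInverse_of_injective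
    (LinearMap.range f).ker_subtype
  refine ⟨LinearMap.toMatrix' (g ∘ₗ p), Matrix.toLin'.injective ?_⟩
  rw [Matrix.toLin'_mul, Matrix.toLin'_mul, Matrix.toLin'_toMatrix']
  refine LinearMap.ext fun x => ?_
  have h1 : p (f x) = f.rangeRestrict x := LinearMap.congr_fun hp (f.rangeRestrict x)
  have h2 := LinearMap.congr_fun hg (f.rangeRestrict x)
  change f (g (p (f x))) = f x
  rw [h1]
  exact congrArg Subtype.val h2

/-- A linear combination of finitely many systems of matrix units has a generalized inverse. -/
theorem exists_mul_mul_self_of_matrixUnits {K R B : Type*} [Field K] [NonUnitalRing R] [Module K R]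
    [IsScalarTower K R R] [SMulCommClass K R R] [Fintype B] {ι : B → Type*} [∀ b, Fintype (ι b)]
    (E : ∀ b, ι b → ι b → R) (hE : ∀ b i j l, E b i j * E b j l = E b i l)
    (hE' : ∀ b i j k l, j ≠ k → E b i j * E b k l = 0)
    (hE'' : ∀ b c i j k l, b ≠ c → E b i j * E c k l = 0) {x : R}
    (hx : x ∈ Submodule.span K {y | ∃ b i j, y = E b i j}) : ∃ y, x * y * x = x := by
  classical
  -- Only multiplicativity of `Φ` and its image matter, not injectivity; some matrix units may
  -- therefore vanish.
  let Φ : (∀ b, Matrix (ι b) (ι b) K) →ₗ[K] R :=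
    { toFun := fun A => ∑ b, ∑ i, ∑ j, A b i j • E b i j
      map_add' := fun A B => by simp [add_smul, Finset.sum_add_distrib]
      map_smul' := fun k A => by simp [mul_smul, Finset.smul_sum] }
  have hΦ (A : ∀ b, Matrix (ι b) (ι b) K) : Φ A = ∑ b, ∑ i, ∑ j, A b i j • E b i j := rfl
  have mul (A A' : ∀ b, Matrix (ι b) (ι b) K) : Φ A * Φ A' = Φ (A * A') := by
    rw [hΦ, hΦ, hΦ, Finset.sum_mul]
    refine Finset.sum_congr rfl fun b _ => ?_
    rw [Finset.mul_sum, Finset.sum_eq_single b]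
    · rw [Finset.sum_mul]
      refine Finset.sum_congr rfl fun i _ => ?_
      have h (j : ι b) : A b i j • E b i j * ∑ k, ∑ l, A' b k l • E b k l =
          ∑ l, (A b i j * A' b j l) • E b i l := by
        rw [Finset.mul_sum, Finset.sum_eq_single j]
        · rw [Finset.mul_sum]
          exact Finset.sum_congr rfl fun l _ => by rw [smul_mul_smul_comm, hE]
        · intro k _ hk
          rw [Finset.mul_sum]
          exact Finset.sum_eq_zero fun l _ => by
            rw [smul_mul_smul_comm, hE' _ _ _ _ _ hk.symm, smul_zero]
        · simp
      rw [Finset.sum_mul, Finset.sum_congr rfl fun j _ => h j, Finset.sum_comm]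
      exact Finset.sum_congr rfl fun l _ => by
        rw [← Finset.sum_smul, Pi.mul_apply, Matrix.mul_apply]
    · intro c _ hc
      simp only [Finset.sum_mul, Finset.mul_sum]
      refine Finset.sum_eq_zero fun i _ => Finset.sum_eq_zero fun j _ =>
        Finset.sum_eq_zero fun k _ => Finset.sum_eq_zero fun l _ => ?_
      rw [smul_mul_smul_comm, hE'' _ _ _ _ _ _ hc.symm, smul_zero]
    · simp
  have hrange : Submodule.span K {y | ∃ b i j, y = E b i j} ≤ LinearMap.range Φ := by
    rw [Submodule.span_le]
    rintro _ ⟨b, i, j, rfl⟩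
    refine ⟨Pi.single b (Matrix.single i j 1), ?_⟩
    rw [hΦ, Finset.sum_eq_single b, Finset.sum_eq_single i, Finset.sum_eq_single j]
    · simp
    · intro k _ hk
      simp [hk.symm]
    · simp
    · intro k _ hk
      simp [hk.symm]
    · simp
    · intro c _ hc
      simp [hc]
    · simp
  obtain ⟨A, rfl⟩ := hrange hx
  choose A' hA' using fun b => (A b).exists_mul_mul_self
  refine ⟨Φ A', ?_⟩
  rw [mul, mul]
  exact congrArg Φ (funext hA')

namespace LeavittPathAlgebra

open QuiverArrow

variable {K : Type w} [Field K] {V : Type u} [Quiver.{v} V]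

section Acyclic

/-- The stretch between two occurrences of an arrow would be a closed path. -/
theorem nodup_of_isPath (hV : ∀ a : V, ¬ QuiverReach a a) {l : List (QuiverArrow V)} {b : V}
    (hl : IsPath l b) : l.Nodup := by
  induction l with
  | nil => simp
  | cons e l ih => exact List.nodup_cons.2 ⟨fun he => hV _ (hl.reach_source he), ih hl.2⟩

section Cap

variable (K)

open Classical in
/-- The vertex `b`, minus the projections onto the arrows in `F` that start at `b`. -/
noncomputable def cap (F : Finset (QuiverArrow V)) (b : V) : LeavittPathAlgebra K V :=
  vertex K b - ∑ e ∈ F with e.s = b, arrow K e * ghost K e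

variable {K} {F : Finset (QuiverArrow V)}

theorem ghost_mul_cap {e : QuiverArrow V} (he : e ∈ F) (b : V) : ghost K e * cap K F b = 0 := by
  classical
  have h (f : QuiverArrow V) (hf : f ≠ e) : ghost K e * (arrow K f * ghost K f) = 0 := by
    rw [← mul_assoc, ghost_mul_arrow_of_ne hf.symm, zero_mul]
  rw [cap, mul_sub, Finset.mul_sum, sub_eq_zero]
  rcases eq_or_ne e.s b with rfl | hb
  · rw [ghost_mul_source, Finset.sum_eq_single e]
    · rw [← mul_assoc, ghost_mul_arrow_self, range_mul_ghost]
    · exact fun f _ hf => h f hf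
    · simp [he]
  · rw [ghost_mul_vertex_of_ne hb]
    refine (Finset.sum_eq_zero fun f hf => h f ?_).symm
    rintro rfl
    exact hb (Finset.mem_filter.1 hf).2

theorem cap_mul_arrow {e : QuiverArrow V} (he : e ∈ F) (b : V) : cap K F b * arrow K e = 0 := by
  classical
  have h (f : QuiverArrow V) (hf : f ≠ e) : (arrow K f * ghost K f) * arrow K e = 0 := by
    rw [mul_assoc, ghost_mul_arrow_of_ne hf, mul_zero]
  rw [cap, sub_mul, Finset.sum_mul, sub_eq_zero]
  rcases eq_or_ne b e.s with rfl | hb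
  · rw [source_mul_arrow, Finset.sum_eq_single e]
    · rw [mul_assoc, ghost_mul_arrow_self, arrow_mul_range]
    · exact fun f _ hf => h f hf
    · simp [he]
  · rw [vertex_mul_arrow_of_ne hb]
    refine (Finset.sum_eq_zero fun f hf => h f ?_).symm
    rintro rfl
    exact hb (Finset.mem_filter.1 hf).2.symm

theorem vertex_mul_cap (b : V) : vertex K b * cap K F b = cap K F b := by
  classical
  rw [cap, mul_sub, vertex_mul_self, Finset.mul_sum]
  congr 1
  refine Finset.sum_congr rfl fun e he => ?_
  rw [← mul_assoc, ← (Finset.mem_filter.1 he).2, source_mul_arrow]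

theorem cap_mul_vertex (b : V) : cap K F b * vertex K b = cap K F b := by
  classical
  rw [cap, sub_mul, vertex_mul_self, Finset.sum_mul]
  congr 1
  refine Finset.sum_congr rfl fun e he => ?_
  rw [mul_assoc, ← (Finset.mem_filter.1 he).2, ghost_mul_source]

theorem cap_mul_cap_self (b : V) : cap K F b * cap K F b = cap K F b := by
  classical
  nth_rw 1 [cap]
  rw [sub_mul, vertex_mul_cap, Finset.sum_mul, Finset.sum_eq_zero, sub_zero]
  intro e he
  rw [mul_assoc, ghost_mul_cap (Finset.mem_filter.1 he).1, mul_zero]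

theorem cap_mul_ghostPath_mul_path_mul_cap_self {l : List (QuiverArrow V)} {b : V}
    (hl : IsPath l b) :
    cap K F b * (ghostPath K l b * path K l b) * cap K F b = cap K F b := by
  rw [ghostPath_mul_path_self hl, cap_mul_vertex, cap_mul_cap_self]

/-- Common initial arrows cancel. If the next arrows differ, relation (4) gives zero; if only one
path ends, the cap at its end kills the next arrow of the other; if both end together, the paths
agree and `b ≠ c`. -/
theorem cap_mul_ghostPath_mul_path_mul_cap_of_ne {l m : List (QuiverArrow V)} {b c : V}
    (hl : IsPath l c) (hlF : ∀ e ∈ l, e ∈ F) (hmF : ∀ e ∈ m, e ∈ F)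
    (hne : b ≠ c ∨ m ≠ l) :
    cap K F b * (ghostPath K m b * path K l c) * cap K F c = 0 := by
  induction m generalizing l with
  | nil =>
    cases l with
    | nil =>
      have hbc : b ≠ c := by simpa using hne
      simp [vertex_mul_of_ne hbc]
    | cons f l =>
      rw [ghostPath_nil, ← mul_assoc, cap_mul_vertex, path_cons, ← mul_assoc,
        cap_mul_arrow (hlF f (by simp)), zero_mul, zero_mul]
  | cons e m ih =>
    cases l with
    | nil =>
      rw [path_nil, mul_assoc, mul_assoc, vertex_mul_cap, ghostPath_cons, mul_assoc,
        ghost_mul_cap (hmF e (by simp)), mul_zero, mul_zero]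
    | cons f l =>
      rw [isPath_cons] at hl
      rw [ghostPath_cons, path_cons, mul_assoc (ghostPath K m b), ← mul_assoc (ghost K e)]
      rcases eq_or_ne e f with rfl | hef
      · rw [ghost_mul_arrow_self, hl.1, source_mul_path]
        exact ih hl.2 (fun e he => hlF e (by simp [he])) (fun e he => hmF e (by simp [he]))
          (by simpa using hne)
      · simp [ghost_mul_arrow_of_ne hef]

open Classical in
-- Insert `b = cap b + ∑ e e*` between the two paths.
theorem path_mul_ghostPath_eq (l m : List (QuiverArrow V)) (b : V) :
    path K l b * ghostPath K m b = path K l b * cap K F b * ghostPath K m b +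
      ∑ e ∈ F with e.s = b, path K (l ++ [e]) e.r * ghostPath K (m ++ [e]) e.r := by
  have h (e : QuiverArrow V) (he : e ∈ F.filter fun e => e.s = b) :
      path K (l ++ [e]) e.r * ghostPath K (m ++ [e]) e.r =
        path K l b * (arrow K e * ghost K e) * ghostPath K m b := by
    rw [path_append, ghostPath_append]
    simp only [source_cons, path_cons, path_nil, ghostPath_cons, ghostPath_nil, arrow_mul_range,
      range_mul_ghost, (Finset.mem_filter.1 he).2, mul_assoc]
  rw [Finset.sum_congr rfl h, ← Finset.sum_mul, ← Finset.mul_sum, ← add_mul, ← mul_add, cap,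
    sub_add_cancel, path_mul_vertex]

end Cap

theorem finite_isPath_of_subset (hV : ∀ a : V, ¬ QuiverReach a a) (F : Finset (QuiverArrow V)) :
    {l : List (QuiverArrow V) | (∃ b, IsPath l b) ∧ ∀ e ∈ l, e ∈ F}.Finite := by
  refine ((List.finite_length_le F F.card).image (List.map Subtype.val)).subset ?_
  rintro l ⟨⟨b, hl⟩, hF⟩
  lift l to List F using hF
  have hn := (nodup_of_isPath hV hl).of_map
  exact ⟨l, by simpa using hn.length_le_card, rfl⟩

/-- Repeated expansion at the common endpoint lengthens both paths, and stops because a path with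
arrows in `F` repeats none and so has length at most `F.card`. -/
theorem path_mul_ghostPath_mem_span (hV : ∀ a : V, ¬ QuiverReach a a)
    {F : Finset (QuiverArrow V)} {W : Set V} (hW : ∀ e ∈ F, e.r ∈ W)
    {l m : List (QuiverArrow V)} {b : V} (hb : b ∈ W) (hl : IsPath l b) (hm : IsPath m b)
    (hlF : ∀ e ∈ l, e ∈ F) (hmF : ∀ e ∈ m, e ∈ F) :
    path K l b * ghostPath K m b ∈ Submodule.span K {x | ∃ l m b, b ∈ W ∧
      (IsPath l b ∧ ∀ e ∈ l, e ∈ F) ∧ (IsPath m b ∧ ∀ e ∈ m, e ∈ F) ∧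
      x = path K l b * cap K F b * ghostPath K m b} := by
  classical
  induction hn : F.card - l.length using Nat.strong_induction_on generalizing l m b with
  | _ n ih =>
    rw [path_mul_ghostPath_eq (F := F)]
    refine Submodule.add_mem _ (Submodule.subset_span ⟨l, m, b, hb, ⟨hl, hlF⟩, ⟨hm, hmF⟩, rfl⟩) ?_
    refine Submodule.sum_mem _ fun e he => ?_
    obtain ⟨heF, rfl⟩ := Finset.mem_filter.1 he
    have hle : IsPath (l ++ [e]) e.r := by simpa [isPath_append] using hl
    have hme : IsPath (m ++ [e]) e.r := by simpa [isPath_append] using hm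
    have hleF : ∀ f ∈ l ++ [e], f ∈ F := by
      simpa [or_imp, forall_and] using ⟨hlF, heF⟩
    have hmeF : ∀ f ∈ m ++ [e], f ∈ F := by
      simpa [or_imp, forall_and] using ⟨hmF, heF⟩
    have hcard : (l ++ [e]).length ≤ F.card := by
      rw [← List.toFinset_card_of_nodup (nodup_of_isPath hV hle)]
      exact Finset.card_le_card fun f hf => hleF f (List.mem_toFinset.1 hf)
    refine ih _ ?_ (hW e heF) hle hme hleF hmeF rfl
    simp only [List.length_append, List.length_singleton] at hcard ⊢
    lia

theorem exists_finset_mem_span (x : LeavittPathAlgebra K V) :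
    ∃ (F : Finset (QuiverArrow V)) (W : Finset V), x ∈ Submodule.span K {x | ∃ l m b, b ∈ W ∧
      (IsPath l b ∧ ∀ e ∈ l, e ∈ F) ∧ (IsPath m b ∧ ∀ e ∈ m, e ∈ F) ∧
      x = path K l b * ghostPath K m b} := by
  classical
  have hx : x ∈ (⊤ : Submodule K (LeavittPathAlgebra K V)) := trivial
  rw [← span_path_mul_ghostPath] at hx
  induction hx using Submodule.span_induction with
  | mem x hx =>
    obtain ⟨l, m, b, hl, hm, rfl⟩ := hx
    exact ⟨l.toFinset ∪ m.toFinset, {b}, Submodule.subset_span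
      ⟨l, m, b, by simp, ⟨hl, by simp +contextual⟩, ⟨hm, by simp +contextual⟩, rfl⟩⟩
  | zero => exact ⟨∅, ∅, Submodule.zero_mem _⟩
  | add x y _ _ hx hy =>
    obtain ⟨F, W, hx⟩ := hx
    obtain ⟨F', W', hy⟩ := hy
    refine ⟨F ∪ F', W ∪ W', Submodule.add_mem _ (Submodule.span_mono ?_ hx)
      (Submodule.span_mono ?_ hy)⟩
    · rintro _ ⟨l, m, b, hb, ⟨hl, hl'⟩, ⟨hm, hm'⟩, rfl⟩
      exact ⟨l, m, b, Finset.mem_union_left _ hb,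
        ⟨hl, fun e he => Finset.mem_union_left _ (hl' e he)⟩,
        ⟨hm, fun e he => Finset.mem_union_left _ (hm' e he)⟩, rfl⟩
    · rintro _ ⟨l, m, b, hb, ⟨hl, hl'⟩, ⟨hm, hm'⟩, rfl⟩
      exact ⟨l, m, b, Finset.mem_union_right _ hb,
        ⟨hl, fun e he => Finset.mem_union_right _ (hl' e he)⟩,
        ⟨hm, fun e he => Finset.mem_union_right _ (hm' e he)⟩, rfl⟩
  | smul k x _ hx =>
    obtain ⟨F, W, hx⟩ := hx
    exact ⟨F, W, Submodule.smul_mem _ k hx⟩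

theorem isVonNeumannRegular_of_acyclic (hV : ∀ a : V, ¬ QuiverReach a a) :
    IsVonNeumannRegular (LeavittPathAlgebra K V) := by
  classical
  intro x
  obtain ⟨F, W₀, hx⟩ := exists_finset_mem_span x
  -- Expansion moves endpoints to ranges of arrows in `F`, so these must be included.
  let W : Finset V := W₀ ∪ F.image fun e => e.r
  let ι (b : W) : Type _ := {l : List (QuiverArrow V) // IsPath l b ∧ ∀ e ∈ l, e ∈ F}
  have hfin (b : W) : Finite (ι b) :=
    ((finite_isPath_of_subset hV F).subset fun l hl => ⟨⟨b, hl.1⟩, hl.2⟩).to_subtype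
  have (b : W) : Fintype (ι b) := Fintype.ofFinite _
  have hassoc (p c q p' c' q' : LeavittPathAlgebra K V) :
      p * c * q * (p' * c' * q') = p * (c * (q * p') * c') * q' := by simp only [mul_assoc]
  refine exists_mul_mul_self_of_matrixUnits (K := K) (ι := ι)
    (fun b l m => path K l.1 b * cap K F b * ghostPath K m.1 b) ?_ ?_ ?_ ?_
  · intro b i j l
    rw [hassoc, cap_mul_ghostPath_mul_path_mul_cap_self j.2.1]
  · intro b i j k l hjk
    rw [hassoc, cap_mul_ghostPath_mul_path_mul_cap_of_ne k.2.1 k.2.2 j.2.2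
      (Or.inr fun h => hjk (Subtype.ext h)), mul_zero, zero_mul]
  · intro b c i j k l hbc
    rw [hassoc, cap_mul_ghostPath_mul_path_mul_cap_of_ne k.2.1 k.2.2 j.2.2
      (Or.inl fun h => hbc (Subtype.ext h)), mul_zero, zero_mul]
  · refine Submodule.span_le.2 ?_ hx
    rintro _ ⟨l, m, b, hb, ⟨hl, hl'⟩, ⟨hm, hm'⟩, rfl⟩
    refine Submodule.span_mono ?_ (path_mul_ghostPath_mem_span (W := (W : Set V)) hV ?_ ?_
      hl hm hl' hm')
    · rintro _ ⟨l, m, b, hb, hl, hm, rfl⟩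
      exact ⟨⟨b, hb⟩, ⟨l, hl⟩, ⟨m, hm⟩, rfl⟩
    · exact fun e he => Finset.mem_union_right _ (Finset.mem_image_of_mem _ he)
    · exact Finset.mem_union_left _ hb

theorem finite_of_acyclic [Finite V] [Finite (QuiverArrow V)] (hV : ∀ a : V, ¬ QuiverReach a a) :
    Module.Finite K (LeavittPathAlgebra K V) := by
  cases nonempty_fintype (QuiverArrow V)
  have h := (finite_isPath_of_subset hV Finset.univ)
  refine ⟨?_⟩
  rw [← span_path_mul_ghostPath]
  refine Submodule.fg_span ((((h.prod h).prod (Set.finite_univ (α := V))).image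
    fun x => path K x.1.1 x.2 * ghostPath K x.1.2 x.2).subset ?_)
  rintro _ ⟨l, m, b, hl, hm, rfl⟩
  exact ⟨((l, m), b), ⟨⟨⟨⟨b, hl⟩, by simp⟩, ⟨⟨b, hm⟩, by simp⟩⟩, trivial⟩, rfl⟩

end Acyclic

section Unit

theorem sum_vertex_mul [Fintype V] (x : LeavittPathAlgebra K V) :
    (∑ a : V, vertex K a) * x = x := by
  have hx : x ∈ (⊤ : Submodule K (LeavittPathAlgebra K V)) := trivial
  rw [← span_path_mul_ghostPath] at hx
  induction hx using Submodule.span_induction with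
  | mem x hx =>
    obtain ⟨l, m, b, -, -, rfl⟩ := hx
    rw [← mul_assoc, Finset.sum_mul, Finset.sum_eq_single (source l b), source_mul_path]
    · exact fun a _ ha => vertex_mul_path_of_ne ha
    · simp
  | zero => exact mul_zero _
  | add x y _ _ hx hy => rw [mul_add, hx, hy]
  | smul k x _ hx => rw [mul_smul_comm, hx]

/-- Ideals are not assumed closed under scalars; the left identity `∑ a` supplies this. -/
theorem smul_mem_leftIdeal [Finite V] (I : NonUnitalLeftIdeal (LeavittPathAlgebra K V)) (k : K)
    {x : LeavittPathAlgebra K V} (hx : x ∈ I.carrier) : k • x ∈ I.carrier := by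
  cases nonempty_fintype V
  rw [← sum_vertex_mul x, ← smul_mul_assoc]
  exact I.mul_mem_left _ hx

theorem isLeftArtinian_of_acyclic [Finite V] [Finite (QuiverArrow V)]
    (hV : ∀ a : V, ¬ QuiverReach a a) : IsLeftArtinian (LeavittPathAlgebra K V) := by
  have := finite_of_acyclic (K := K) hV
  have : IsArtinian K (LeavittPathAlgebra K V) := inferInstance
  let f (I : NonUnitalLeftIdeal (LeavittPathAlgebra K V)) :
      Submodule K (LeavittPathAlgebra K V) :=
    { I.toAddSubgroup with smul_mem' := fun k _ hx => smul_mem_leftIdeal I k hx }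
  have hf : StrictMono f := fun I J hIJ => hIJ
  exact hf.wellFoundedLT

end Unit

end LeavittPathAlgebra

/-! ### Closed paths without exits and the noetherian property -/

namespace LeavittPathAlgebra

open QuiverArrow

section NoExit

variable {V : Type u} [Quiver.{v} V]

theorem vertex_induction [Finite V] {P : V → Prop} (cycle : ∀ a, QuiverReach a a → P a)
    (sink : ∀ a, IsEmpty (Quiver.Star a) → P a)
    (step : ∀ a, Nonempty (Quiver.Star a) → (∀ e : Quiver.Star a, P e.1) → P a) (a : V) : P a := by
  -- Requiring that `a` lie on no closed path makes reachability irreflexive, hence well-founded on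
  -- a finite vertex set.
  let r (b a : V) : Prop := QuiverReach a b ∧ ¬ QuiverReach a a
  have : IsTrans V r := ⟨fun a b c hab hbc => ⟨hbc.1.trans hab.1, hbc.2⟩⟩
  have : Std.Irrefl r := ⟨fun a h => h.2 h.1⟩
  refine (Finite.wellFounded_of_trans_of_irrefl r).induction a fun a ih => ?_
  by_cases ha : QuiverReach a a
  · exact cycle a ha
  · rcases isEmpty_or_nonempty (Quiver.Star a) with h | h
    · exact sink a h
    · exact step a h fun e => ih _ ⟨QuiverReach.arrow ⟨a, e⟩, ha⟩

/-- The only arrow leaving a vertex on a closed path continues that path, so one can always return.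
-/
theorem reach_symm_of_noExit (hV : ∀ a : V, QuiverReach a a → Subsingleton (Quiver.Star a))
    {a b : V} (ha : QuiverReach a a) (hab : QuiverReach a b) : QuiverReach b a := by
  have step {a c : V} (ha : QuiverReach a a) (hac : Nonempty (a ⟶ c)) : QuiverReach c a := by
    obtain ⟨e⟩ := hac
    have := hV a ha
    obtain ⟨c', ⟨e'⟩, h⟩ := Relation.TransGen.head'_iff.1 ha
    have hcc : (⟨c', e'⟩ : Quiver.Star a) = ⟨c, e⟩ := Subsingleton.elim _ _
    obtain rfl : c' = c := congrArg Sigma.fst hcc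
    rcases Relation.reflTransGen_iff_eq_or_transGen.1 h with rfl | h
    · exact ha
    · exact h
  induction hab with
  | single h => exact step ha h
  | tail hab hbc ih => exact (step (ih.trans hab) hbc).trans ih

/-- Paths from a vertex on a closed path never have a choice of arrow, so the shorter is a prefix of
the longer. -/
theorem isPath_prefix_of_noExit
    (hV : ∀ a : V, QuiverReach a a → Subsingleton (Quiver.Star a))
    {l m : List (QuiverArrow V)} {b c : V} (hl : IsPath l b) (hm : IsPath m c)
    (h : source l b = source m c) (hcyc : QuiverReach (source l b) (source l b))
    (hle : l.length ≤ m.length) : ∃ d, m = l ++ d ∧ source d c = b ∧ IsPath d c := by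
  induction l generalizing m with
  | nil => exact ⟨m, rfl, h.symm, hm⟩
  | cons e l ih =>
    cases m with
    | nil => simp at hle
    | cons f m =>
      obtain ⟨a, e⟩ := e
      obtain ⟨a', f⟩ := f
      obtain rfl : a = a' := h
      have := hV a hcyc
      obtain rfl : e = f := Subsingleton.elim (α := Quiver.Star a) _ _
      have hr := QuiverReach.arrow (⟨a, e⟩ : QuiverArrow V)
      obtain ⟨d, rfl, hd⟩ := ih hl.2 hm.2 (hl.1.symm.trans hm.1)
        (by rw [← hl.1]; exact (reach_symm_of_noExit hV hcyc hr).trans hr) (by simpa using hle)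
      exact ⟨d, rfl, hd⟩

/-- Where only one arrow `e` leaves, relation (5) reads `s(e) = e e*`; the product then telescopes.
-/
theorem path_mul_ghostPath_self_of_noExit {K : Type w} [Field K]
    (hV : ∀ a : V, QuiverReach a a → Subsingleton (Quiver.Star a))
    {l : List (QuiverArrow V)} {b : V} (hl : IsPath l b)
    (hcyc : QuiverReach (source l b) (source l b)) :
    path K l b * ghostPath K l b = vertex K (source l b) := by
  induction l with
  | nil => simp
  | cons e l ih =>
    have hr := QuiverReach.arrow e
    rw [path_cons, ghostPath_cons, mul_assoc, ← mul_assoc (path K l b), ih hl.2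
      (by rw [← hl.1]; exact (reach_symm_of_noExit hV hcyc hr).trans hr), ← hl.1, range_mul_ghost]
    have : Subsingleton (Quiver.Star e.s) := hV _ hcyc
    let _ : Unique (Quiver.Star e.s) := ⟨⟨e.2⟩, fun _ => Subsingleton.elim _ _⟩
    exact (vertex_eq_sum e.s).trans (Fintype.sum_unique _) |>.symm

end NoExit

variable {K : Type w} [Field K] {V : Type u} [Quiver.{v} V]

/-- Every ascending chain of left ideals becomes stationary after multiplication by the
vertex `a`. -/
def ChainsStabilizeAt (K : Type w) [Field K] (a : V) : Prop :=
  ∀ I : ℕ →o NonUnitalLeftIdeal (LeavittPathAlgebra K V),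
    ∃ n, ∀ m, n ≤ m → ∀ x ∈ (I m).carrier, vertex K a * x ∈ (I n).carrier

theorem isLeftNoetherian_of_chainsStabilizeAt [Finite V]
    (h : ∀ a : V, ChainsStabilizeAt K a) : IsLeftNoetherian (LeavittPathAlgebra K V) := by
  cases nonempty_fintype V
  refine wellFoundedGT_iff_monotone_chain_condition.2 fun I => ?_
  choose n hn using fun a => h a I
  refine ⟨Finset.univ.sup n, fun m hm => le_antisymm (I.monotone hm) fun x hx => ?_⟩
  rw [← sum_vertex_mul x, Finset.sum_mul]
  exact (I _).toAddSubgroup.sum_mem fun a _ =>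
    I.monotone (Finset.le_sup (Finset.mem_univ a)) (hn a m ((Finset.le_sup
      (Finset.mem_univ a)).trans hm) x hx)

/-- Write `a x = ∑ e (e* x)`: each `e* x` lies in the ideal and starts at the range of `e`, where
the chain stabilizes. -/
theorem ChainsStabilizeAt.of_star {a : V} [Finite (Quiver.Star a)] [Nonempty (Quiver.Star a)]
    (h : ∀ e : Quiver.Star a, ChainsStabilizeAt K e.1) : ChainsStabilizeAt K a := by
  cases nonempty_fintype (Quiver.Star a)
  intro I
  choose n hn using fun e => h e I
  refine ⟨Finset.univ.sup n, fun m hm x hx => ?_⟩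
  rw [vertex_eq_sum, Finset.sum_mul]
  refine (I _).toAddSubgroup.sum_mem fun e _ =>
    I.monotone (Finset.le_sup (Finset.mem_univ e)) ?_
  have := hn e m ((Finset.le_sup (Finset.mem_univ e)).trans hm) _
    ((I m).mul_mem_left (ghost K ⟨a, e⟩) hx)
  rw [← mul_assoc, range_mul_ghost ⟨a, e⟩] at this
  rw [mul_assoc]
  exact (I _).mul_mem_left _ this

/-- The operators generated by left multiplication by `c` and `c'`. -/
noncomputable abbrev leftMulAdjoin (c c' : LeavittPathAlgebra K V) :
    Subalgebra K (Module.End K (LeavittPathAlgebra K V)) :=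
  Algebra.adjoin K {LinearMap.mulLeft K c, LinearMap.mulLeft K c'}

open scoped IsMulCommutative in
-- It is a commutative finitely generated `K`-algebra, so Hilbert's basis theorem applies.
theorem isNoetherianRing_leftMulAdjoin {c c' : LeavittPathAlgebra K V} (hc : c * c' = c' * c) :
    IsNoetherianRing (leftMulAdjoin c c') := by
  have hcomm : ∀ a ∈ ({LinearMap.mulLeft K c, LinearMap.mulLeft K c'} : Set (Module.End K _)),
      ∀ b ∈ ({LinearMap.mulLeft K c, LinearMap.mulLeft K c'} : Set (Module.End K _)),
      a * b = b * a := by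
    have h : LinearMap.mulLeft K c * LinearMap.mulLeft K c' =
        LinearMap.mulLeft K c' * LinearMap.mulLeft K c :=
      LinearMap.ext fun x => by simp [← mul_assoc, hc]
    rintro a (rfl | rfl) b (rfl | rfl)
    exacts [rfl, h, h.symm, rfl]
  have : IsMulCommutative (leftMulAdjoin c c') := Algebra.isMulCommutative_adjoin K hcomm
  have : Algebra.FiniteType K (leftMulAdjoin c c') :=
    (Subalgebra.fg_iff_finiteType _).1 (Subalgebra.fg_def.2 ⟨_, Set.toFinite _, rfl⟩)
  exact Algebra.FiniteType.isNoetherianRing K (leftMulAdjoin c c')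

theorem mul_mem_of_leftMulAdjoin {c c' : LeavittPathAlgebra K V}
    (N : Submodule (leftMulAdjoin c c') (LeavittPathAlgebra K V)) {x : LeavittPathAlgebra K V}
    (hx : x ∈ N) : c * x ∈ N ∧ c' * x ∈ N :=
  ⟨N.smul_mem ⟨LinearMap.mulLeft K c, Algebra.subset_adjoin (by simp)⟩ hx,
    N.smul_mem ⟨LinearMap.mulLeft K c', Algebra.subset_adjoin (by simp)⟩ hx⟩

/-- A left ideal, as a module over the operators generated by two left multiplications. -/
def leftIdealSubmodule [Finite V] (c c' : LeavittPathAlgebra K V)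
    (I : NonUnitalLeftIdeal (LeavittPathAlgebra K V)) :
    Submodule (leftMulAdjoin c c') (LeavittPathAlgebra K V) :=
  { I.toAddSubgroup with
    smul_mem' := by
      rintro ⟨f, hf⟩ x hx
      change f x ∈ I.carrier
      induction hf using Algebra.adjoin_induction generalizing x with
      | mem f hf =>
        rcases hf with rfl | rfl <;> exact I.mul_mem_left _ hx
      | algebraMap k => exact smul_mem_leftIdeal I k hx
      | add f g _ _ hf hg => exact I.add_mem' (hf hx) (hg hx)
      | mul f g _ _ hf hg => exact hf (hg hx) }

/-- The left ideals cut out submodules of the noetherian module `N`, which contains all `a x`. -/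
theorem chainsStabilizeAt_of_fg [Finite V] {a : V} {c c' : LeavittPathAlgebra K V}
    (hc : c * c' = c' * c) {N : Submodule (leftMulAdjoin c c') (LeavittPathAlgebra K V)}
    (hN : N.FG) (h : ∀ x, vertex K a * x ∈ N) : ChainsStabilizeAt K a := by
  intro I
  have := isNoetherianRing_leftMulAdjoin hc
  have := isNoetherian_of_fg_of_noetherian N hN
  obtain ⟨n, hn⟩ := monotone_stabilizes_iff_noetherian.2 this
    ⟨fun n => (leftIdealSubmodule c c' (I n)).comap N.subtype,
      fun i j hij x hx => I.monotone hij hx⟩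
  refine ⟨n, fun m hm x hx => ?_⟩
  have hmem : (⟨vertex K a * x, h x⟩ : N) ∈
      (leftIdealSubmodule c c' (I m)).comap N.subtype := (I m).mul_mem_left _ hx
  have heq := hn m hm
  change (leftIdealSubmodule c c' (I n)).comap N.subtype =
    (leftIdealSubmodule c c' (I m)).comap N.subtype at heq
  rw [← heq] at hmem
  exact hmem

/-- Right multiplication is linear over the operators generated by left multiplications. -/
noncomputable def mulRightLeftMulAdjoin (c c' y : LeavittPathAlgebra K V) :
    LeavittPathAlgebra K V →ₗ[leftMulAdjoin c c'] LeavittPathAlgebra K V :=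
  { LinearMap.mulRight K y with
    map_smul' := by
      rintro ⟨f, hf⟩ x
      change f x * y = f (x * y)
      induction hf using Algebra.adjoin_induction generalizing x with
      | mem f hf =>
        rcases hf with rfl | rfl <;> exact mul_assoc _ _ _
      | algebraMap k => exact smul_mul_assoc k x y
      | add f g _ _ hf hg => rw [LinearMap.add_apply, add_mul, hf, hg]; rfl
      | mul f g _ _ hf hg => rw [Module.End.mul_apply, hf, hg]; rfl }

/-- Write `x a = ∑ (x e) e*`; right multiplication by `e*` is linear over the operators and
preserves finite generation. -/
theorem exists_fg_of_star {w a : V} {c c' : LeavittPathAlgebra K V} [Finite (Quiver.Star a)]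
    [Nonempty (Quiver.Star a)]
    (h : ∀ e : Quiver.Star a, ∃ N : Submodule (leftMulAdjoin c c') (LeavittPathAlgebra K V),
      N.FG ∧ ∀ x, vertex K w * x * vertex K e.1 ∈ N) :
    ∃ N : Submodule (leftMulAdjoin c c') (LeavittPathAlgebra K V),
      N.FG ∧ ∀ x, vertex K w * x * vertex K a ∈ N := by
  cases nonempty_fintype (Quiver.Star a)
  choose N hN hmem using h
  refine ⟨⨆ e, (N e).map (mulRightLeftMulAdjoin c c' (ghost K ⟨a, e⟩)),
    Submodule.fg_iSup _ fun e => (hN e).map _, fun x => ?_⟩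
  rw [vertex_eq_sum a, Finset.mul_sum]
  refine Submodule.sum_mem _ fun e _ => Submodule.mem_iSup_of_mem e
    ⟨vertex K w * (x * arrow K ⟨a, e⟩) * vertex K e.1, hmem e _, ?_⟩
  change _ * ghost K ⟨a, e⟩ = _
  rw [mul_assoc, range_mul_ghost ⟨a, e⟩]
  simp only [mul_assoc]

theorem mul_sum_vertex [Fintype V] (x : LeavittPathAlgebra K V) :
    x * (∑ a : V, vertex K a) = x := by
  -- A left identity `u` satisfies `u u* = u*`; applying the involution gives `u u* = u`, so `u* =
  -- u`.
  have h : inv (∑ a : V, vertex K a) = ∑ a : V, vertex K a := by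
    have h1 := sum_vertex_mul (inv (∑ a : V, vertex K a))
    have h2 := congrArg inv h1
    rwa [inv_mul, inv_inv, h1] at h2
  rw [← inv_inv (x * _), inv_mul, h, sum_vertex_mul, inv_inv]

theorem mul_mul_mem_of_path_mul_ghostPath_mem {w a : V} {c c' : LeavittPathAlgebra K V}
    (N : Submodule (leftMulAdjoin c c') (LeavittPathAlgebra K V))
    (h : ∀ l m b, IsPath l b → IsPath m b → source l b = w → source m b = a →
      path K l b * ghostPath K m b ∈ N) (x : LeavittPathAlgebra K V) :
    vertex K w * x * vertex K a ∈ N := by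
  have hx : x ∈ (⊤ : Submodule K (LeavittPathAlgebra K V)) := trivial
  rw [← span_path_mul_ghostPath] at hx
  induction hx using Submodule.span_induction with
  | mem x hx =>
    obtain ⟨l, m, b, hl, hm, rfl⟩ := hx
    rw [← mul_assoc, mul_assoc]
    rcases eq_or_ne w (source l b) with rfl | hw
    · rcases eq_or_ne (source m b) a with rfl | ha
      · rw [source_mul_path, ghostPath_mul_source]
        exact h l m b hl hm rfl rfl
      · simp [ghostPath_mul_vertex_of_ne ha]
    · simp [vertex_mul_path_of_ne hw]
  | zero => simp
  | add x y _ _ hx hy =>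
    rw [mul_add, add_mul]
    exact N.add_mem hx hy
  | smul k x _ hx =>
    rw [mul_smul_comm, smul_mul_assoc]
    exact N.smul_of_tower_mem k hx

theorem eq_nil_of_isEmpty_star {a b : V} (h : IsEmpty (Quiver.Star a)) {l : List (QuiverArrow V)}
    (hl : source l b = a) : l = [] := by
  cases l with
  | nil => rfl
  | cons e l =>
    subst hl
    exact h.elim e.2

theorem not_reach_of_isEmpty_star {a b : V} (h : IsEmpty (Quiver.Star a)) :
    ¬ QuiverReach a b := by
  intro hab
  obtain ⟨c, ⟨e⟩, -⟩ := Relation.TransGen.head'_iff.1 hab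
  exact h.elim ⟨c, e⟩

/-- No path leaves `w`, and a vertex on a closed path cannot reach a sink, so at most the multiples
of `w` remain. With `0` as both generators the operators are just the scalars. -/
theorem exists_fg_of_sink (hV : ∀ a : V, QuiverReach a a → Subsingleton (Quiver.Star a))
    {w : V} (hw : IsEmpty (Quiver.Star w)) {a : V}
    (ha : QuiverReach a a ∨ IsEmpty (Quiver.Star a)) :
    ∃ N : Submodule (leftMulAdjoin (0 : LeavittPathAlgebra K V) 0) (LeavittPathAlgebra K V),
      N.FG ∧ ∀ x, vertex K w * x * vertex K a ∈ N := by
  refine ⟨Submodule.span _ {vertex K w}, Submodule.fg_span_singleton _,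
    mul_mul_mem_of_path_mul_ghostPath_mem _ fun l m b hl hm hlw hma => ?_⟩
  obtain rfl := eq_nil_of_isEmpty_star hw hlw
  obtain rfl : b = w := hlw
  obtain rfl : m = [] := by
    by_contra hne
    have hr := hm.reach hne
    rw [hma] at hr
    rcases ha with ha | ha
    · exact not_reach_of_isEmpty_star hw (reach_symm_of_noExit hV ha hr)
    · exact not_reach_of_isEmpty_star ha hr
  exact Submodule.subset_span (vertex_mul_self b)

/-- For `c` a shortest closed path at `w` and `q` a shortest path from `a` to `w`, every spanning
element from `w` to `a` is `cⁱ c*ʲ q*`. Thus `q*` generates. -/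
theorem exists_fg_of_cycle (hV : ∀ a : V, QuiverReach a a → Subsingleton (Quiver.Star a))
    {w : V} (hw : QuiverReach w w) : ∃ c c' : LeavittPathAlgebra K V, c * c' = c' * c ∧
      ∀ a, QuiverReach a a ∨ IsEmpty (Quiver.Star a) →
        ∃ N : Submodule (leftMulAdjoin c c') (LeavittPathAlgebra K V),
          N.FG ∧ ∀ x, vertex K w * x * vertex K a ∈ N := by
  obtain ⟨p, ⟨hpne, hp, hps⟩, hpmin⟩ := (measure List.length).wf.has_min
    {l : List (QuiverArrow V) | l ≠ [] ∧ IsPath l w ∧ source l w = w} hw.exists_isPath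
  have hcyc : QuiverReach (source p w) (source p w) := by rwa [hps]
  refine ⟨path K p w, ghostPath K p w, ?_, fun a ha => ?_⟩
  · rw [path_mul_ghostPath_self_of_noExit hV hp hcyc, ghostPath_mul_path_self hp, hps]
  -- By minimality of `p`, every closed path at `w` is a power of `p`, which is peeled off one
  -- factor at a time.
  have loop (N : Submodule (leftMulAdjoin (path K p w) (ghostPath K p w))
      (LeavittPathAlgebra K V)) {d : List (QuiverArrow V)} (hd : IsPath d w)
      (hds : source d w = w) {y : LeavittPathAlgebra K V} (hy : y ∈ N)
      (hwy : vertex K w * y = y) : path K d w * y ∈ N ∧ ghostPath K d w * y ∈ N := by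
    induction hn : d.length using Nat.strong_induction_on generalizing d y with
    | _ n ih =>
      rcases eq_or_ne d [] with rfl | hdne
      · simpa [hwy] using hy
      · obtain ⟨d, rfl, hd', hdp⟩ := isPath_prefix_of_noExit hV hp hd (hps.trans hds.symm) hcyc
          (not_lt.1 (hpmin d ⟨hdne, hd, hds⟩))
        have hlt : d.length < n := by
          rw [← hn, List.length_append]
          exact Nat.lt_add_of_pos_left (List.length_pos_iff.2 hpne)
        rw [path_append, ghostPath_append, hd', mul_assoc, mul_assoc]
        exact ⟨(mul_mem_of_leftMulAdjoin N (ih _ hlt hdp hd' hy hwy rfl).1).1,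
          (ih _ hlt hdp hd' (mul_mem_of_leftMulAdjoin N hy).2
            (by rw [← mul_assoc, vertex_mul_ghostPath]) rfl).2⟩
  by_cases haw : (∃ q : List (QuiverArrow V), IsPath q w ∧ source q w = a) ∧ QuiverReach a a
  · obtain ⟨haw, ha⟩ := haw
    obtain ⟨q, ⟨hq, hqs⟩, hqmin⟩ := (measure List.length).wf.has_min
      {l : List (QuiverArrow V) | IsPath l w ∧ source l w = a} haw
    refine ⟨Submodule.span _ {ghostPath K q w}, Submodule.fg_span_singleton _,
      mul_mul_mem_of_path_mul_ghostPath_mem _ fun l m b hl hm hlw hma => ?_⟩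
    have hqmem : ghostPath K q w ∈ Submodule.span
        (leftMulAdjoin (path K p w) (ghostPath K p w)) {ghostPath K q w} :=
      Submodule.mem_span_singleton_self _
    -- Choose a path `s` from `b` back to `w`; inserting `s s* = b` moves the common endpoint to
    -- `w`.
    obtain ⟨s, hs, hsb⟩ : ∃ s, IsPath s w ∧ source s w = b := by
      rcases eq_or_ne l [] with rfl | hne
      · exact ⟨[], trivial, hlw.symm⟩
      · have hr := hl.reach hne
        rw [hlw] at hr
        obtain ⟨s, -, hs⟩ := (reach_symm_of_noExit hV hw hr).exists_isPath
        exact ⟨s, hs⟩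
    have hb : QuiverReach b b := by
      rcases eq_or_ne l [] with rfl | hne
      · rwa [show b = w from hlw]
      · have hr := hl.reach hne
        rw [hlw] at hr
        exact (reach_symm_of_noExit hV hw hr).trans hr
    subst hsb
    have h : path K l (source s w) * ghostPath K m (source s w) =
        path K (l ++ s) w * ghostPath K (m ++ s) w := by
      rw [path_append, ghostPath_append, mul_assoc, ← mul_assoc (path K s w),
        path_mul_ghostPath_self_of_noExit hV hs hb, vertex_mul_ghostPath]
    rw [h]
    have hls : IsPath (l ++ s) w := isPath_append.2 ⟨hl, hs⟩
    have hms : IsPath (m ++ s) w := isPath_append.2 ⟨hm, hs⟩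
    have hmss : source (m ++ s) w = a := by rw [source_append, hma]
    refine (loop _ hls (by rw [source_append, hlw]) ?_ (vertex_mul_ghostPath _ _)).1
    obtain ⟨d, hd, hds, hdw⟩ := isPath_prefix_of_noExit hV hq hms (hqs.trans hmss.symm)
      (by rwa [hqs]) (not_lt.1 (hqmin _ ⟨hms, hmss⟩))
    rw [hd, ghostPath_append, hds]
    exact (loop _ hdw hds hqmem (vertex_mul_ghostPath _ _)).2
  -- Here no pair of paths from `w` and `a` meets: `b` would lie on the cycle of `w`, so `a` would
  -- not be a sink and would reach `w`.
  · refine ⟨⊥, Submodule.fg_bot,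
      mul_mul_mem_of_path_mul_ghostPath_mem _ fun l m b hl hm hlw hma => ?_⟩
    have hbw : b = w ∨ QuiverReach b w := by
      rcases eq_or_ne l [] with rfl | hne
      · exact Or.inl hlw
      · have hr := hl.reach hne
        rw [hlw] at hr
        exact Or.inr (reach_symm_of_noExit hV hw hr)
    exfalso
    have hbne : ¬ IsEmpty (Quiver.Star b) := by
      rintro h
      rcases hbw with rfl | hbw
      · exact not_reach_of_isEmpty_star h hw
      · exact not_reach_of_isEmpty_star h hbw
    have ha' : QuiverReach a a := by
      refine ha.resolve_right fun h => ?_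
      obtain rfl := eq_nil_of_isEmpty_star h hma
      obtain rfl : b = a := hma
      exact hbne h
    refine haw ⟨?_, ha'⟩
    rcases hbw with rfl | hbw
    · exact ⟨m, hm, hma⟩
    · obtain ⟨s, -, hs, hsb⟩ := hbw.exists_isPath
      subst hsb
      exact ⟨m ++ s, isPath_append.2 ⟨hm, hs⟩, by rw [source_append, hma]⟩

theorem isLeftNoetherian_of_noExit [Finite V] [∀ a : V, Finite (Quiver.Star a)]
    (hV : ∀ a : V, QuiverReach a a → Subsingleton (Quiver.Star a)) :
    IsLeftNoetherian (LeavittPathAlgebra K V) := by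
  cases nonempty_fintype V
  have key {w : V} {c c' : LeavittPathAlgebra K V} (hc : c * c' = c' * c)
      (h : ∀ a, QuiverReach a a ∨ IsEmpty (Quiver.Star a) →
        ∃ N : Submodule (leftMulAdjoin c c') (LeavittPathAlgebra K V),
          N.FG ∧ ∀ x, vertex K w * x * vertex K a ∈ N) : ChainsStabilizeAt K w := by
    have h' (a : V) : ∃ N : Submodule (leftMulAdjoin c c') (LeavittPathAlgebra K V),
        N.FG ∧ ∀ x, vertex K w * x * vertex K a ∈ N := by
      -- The right-hand vertex is reduced to cycles and sinks first, for fixed `w`; afterwards `w`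
      -- is reduced in the same way.
      induction a using vertex_induction with
      | cycle a ha => exact h a (Or.inl ha)
      | sink a ha => exact h a (Or.inr ha)
      | step a _ ih => exact exists_fg_of_star ih
    choose N hN hmem using h'
    refine chainsStabilizeAt_of_fg hc (Submodule.fg_iSup _ hN) fun x => ?_
    rw [← mul_sum_vertex (vertex K w * x), Finset.mul_sum]
    exact Submodule.sum_mem _ fun a _ => Submodule.mem_iSup_of_mem a (hmem a x)
  refine isLeftNoetherian_of_chainsStabilizeAt fun w => ?_
  induction w using vertex_induction with
  | cycle w hw =>
    obtain ⟨c, c', hc, h⟩ := exists_fg_of_cycle (K := K) hV hw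
    exact key hc h
  | sink w hw => exact key rfl fun a ha => exists_fg_of_sink hV hw ha
  | step w _ ih => exact .of_star ih

end LeavittPathAlgebra

/-! ### Transfer of the quiver conditions to the Kronecker square -/

namespace KroneckerSquare

variable {V : Type u} [Quiver.{v} V]

theorem quiverReach_diagonal {a b : V} (h : QuiverReach a b) :
    QuiverReach (V := KroneckerSquare V) (a, a) (b, b) :=
  Relation.TransGen.lift (fun a : V => ((a, a) : KroneckerSquare V))
    (fun _ _ ⟨e⟩ => ⟨(e, e)⟩) _ _ h

theorem quiverReach_fst {a b : KroneckerSquare V} (h : QuiverReach a b) :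
    QuiverReach a.1 b.1 :=
  Relation.TransGen.lift (fun a : KroneckerSquare V => a.1) (fun _ _ ⟨e⟩ => ⟨e.1⟩) _ _ h

theorem quiverReach_snd {a b : KroneckerSquare V} (h : QuiverReach a b) :
    QuiverReach a.2 b.2 :=
  Relation.TransGen.lift (fun a : KroneckerSquare V => a.2) (fun _ _ ⟨e⟩ => ⟨e.2⟩) _ _ h

/-- The arrows of the Kronecker square with a given source are the pairs of arrows with the given
sources. -/
def starEquiv (a : KroneckerSquare V) :
    Quiver.Star a ≃ Quiver.Star a.1 × Quiver.Star a.2 where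
  toFun e := (⟨e.1.1, e.2.1⟩, ⟨e.1.2, e.2.2⟩)
  invFun e := ⟨(e.1.1, e.2.1), (e.1.2, e.2.2)⟩
  left_inv _ := rfl
  right_inv _ := rfl

theorem acyclic_iff : (∀ a : KroneckerSquare V, ¬ QuiverReach a a) ↔
    ∀ a : V, ¬ QuiverReach a a :=
  ⟨fun h a ha => h (a, a) (quiverReach_diagonal ha), fun h a ha => h a.1 (quiverReach_fst ha)⟩

theorem noExit_iff :
    (∀ a : KroneckerSquare V, QuiverReach a a → Subsingleton (Quiver.Star a)) ↔
      ∀ a : V, QuiverReach a a → Subsingleton (Quiver.Star a) := by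
  refine ⟨fun h a ha => ?_, fun h a ha => ?_⟩
  · have := h (a, a) (quiverReach_diagonal ha)
    have : Subsingleton (Quiver.Star a × Quiver.Star a) :=
      (starEquiv ((a, a) : KroneckerSquare V)).symm.subsingleton
    exact ⟨fun e f => congrArg Prod.fst (Subsingleton.elim (e, e) (f, f))⟩
  · have := h a.1 (quiverReach_fst ha)
    have := h a.2 (quiverReach_snd ha)
    exact (starEquiv a).subsingleton

theorem finite_iff {V : Type u} : Finite (KroneckerSquare V) ↔ Finite V := by
  constructor
  · intro h
    exact Finite.of_injective (β := KroneckerSquare V) (fun a : V => (a, a))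
      fun a b h => congrArg Prod.fst h
  · intro h
    exact inferInstanceAs (Finite (V × V))

/-- Diagonal vertices are used for the forward direction: at `(a, b)` with `b` a sink the star is
empty and says nothing about `a`. -/
theorem finite_star_iff : (∀ a : KroneckerSquare V, Finite (Quiver.Star a)) ↔
    ∀ a : V, Finite (Quiver.Star a) := by
  refine ⟨fun h a => ?_, fun h a => Finite.of_equiv _ (starEquiv a).symm⟩
  have : Finite (Quiver.Star a × Quiver.Star a) :=
    @Finite.of_equiv _ _ (h (a, a)) (starEquiv ((a, a) : KroneckerSquare V))
  exact Finite.of_injective (fun e : Quiver.Star a => (e, e)) fun e f h => congrArg Prod.fst h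

end KroneckerSquare

/-! ### Characterizations by the quiver and the theorem -/

namespace LeavittPathAlgebra

variable {K : Type w} [Field K] {V : Type u} [Quiver.{v} V]

theorem isVonNeumannRegular_iff :
    IsVonNeumannRegular (LeavittPathAlgebra K V) ↔ ∀ a : V, ¬ QuiverReach a a :=
  ⟨not_quiverReach_self_of_isVonNeumannRegular, isVonNeumannRegular_of_acyclic⟩

theorem isLeftNoetherian_iff : IsLeftNoetherian (LeavittPathAlgebra K V) ↔
    Finite V ∧ (∀ a : V, Finite (Quiver.Star a)) ∧
      ∀ a : V, QuiverReach a a → Subsingleton (Quiver.Star a) := by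
  refine ⟨fun h => ⟨?_, fun a => ?_, fun a ha => ?_⟩, fun ⟨_, _, hV⟩ => isLeftNoetherian_of_noExit hV⟩
  · by_contra hV
    exact (not_chain_conditions_of_infinite (not_finite_iff_infinite.1 hV)).1 h
  · by_contra hV
    exact (not_chain_conditions_of_infinite_star (not_finite_iff_infinite.1 hV)).1 h
  · by_contra hV
    exact (not_chain_conditions_of_exit ha hV).1 h

theorem isLeftArtinian_iff : IsLeftArtinian (LeavittPathAlgebra K V) ↔
    Finite V ∧ (∀ a : V, Finite (Quiver.Star a)) ∧ ∀ a : V, ¬ QuiverReach a a := by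
  refine ⟨fun h => ⟨?_, fun a => ?_, not_quiverReach_self_of_isLeftArtinian h⟩, ?_⟩
  · by_contra hV
    exact (not_chain_conditions_of_infinite (not_finite_iff_infinite.1 hV)).2 h
  · by_contra hV
    exact (not_chain_conditions_of_infinite_star (not_finite_iff_infinite.1 hV)).2 h
  · rintro ⟨_, h, hV⟩
    have : Finite (QuiverArrow V) := inferInstanceAs (Finite (Σ a : V, Quiver.Star a))
    exact isLeftArtinian_of_acyclic hV

theorem isLeftNoetherian_kroneckerSquare_iff :
    IsLeftNoetherian (LeavittPathAlgebra K V) ↔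
      IsLeftNoetherian (LeavittPathAlgebra K (KroneckerSquare V)) := by
  rw [isLeftNoetherian_iff, isLeftNoetherian_iff, KroneckerSquare.finite_iff,
    KroneckerSquare.finite_star_iff, KroneckerSquare.noExit_iff]

theorem isLeftArtinian_kroneckerSquare_iff :
    IsLeftArtinian (LeavittPathAlgebra K V) ↔
      IsLeftArtinian (LeavittPathAlgebra K (KroneckerSquare V)) := by
  rw [isLeftArtinian_iff, isLeftArtinian_iff, KroneckerSquare.finite_iff,
    KroneckerSquare.finite_star_iff, KroneckerSquare.acyclic_iff]

end LeavittPathAlgebra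

theorem mainTheorem4 (K : Type w) [Field K] (V : Type u) [Quiver.{v} V] :
    (IsVonNeumannRegular (LeavittPathAlgebra K V) ↔
      IsVonNeumannRegular (LeavittPathAlgebra K (KroneckerSquare V))) ∧
    (IsLeftNoetherian (LeavittPathAlgebra K V) ↔
      IsLeftNoetherian (LeavittPathAlgebra K (KroneckerSquare V))) ∧
    (IsRightNoetherian (LeavittPathAlgebra K V) ↔
      IsRightNoetherian (LeavittPathAlgebra K (KroneckerSquare V))) ∧
    (IsLeftArtinian (LeavittPathAlgebra K V) ↔
      IsLeftArtinian (LeavittPathAlgebra K (KroneckerSquare V))) ∧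
    (IsRightArtinian (LeavittPathAlgebra K V) ↔
      IsRightArtinian (LeavittPathAlgebra K (KroneckerSquare V))) := by
  refine ⟨?_, LeavittPathAlgebra.isLeftNoetherian_kroneckerSquare_iff, ?_,
    LeavittPathAlgebra.isLeftArtinian_kroneckerSquare_iff, ?_⟩
  · rw [LeavittPathAlgebra.isVonNeumannRegular_iff, LeavittPathAlgebra.isVonNeumannRegular_iff,
      KroneckerSquare.acyclic_iff]
  · rw [LeavittPathAlgebra.isRightNoetherian_iff, LeavittPathAlgebra.isRightNoetherian_iff,
      LeavittPathAlgebra.isLeftNoetherian_kroneckerSquare_iff]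
  · rw [LeavittPathAlgebra.isRightArtinian_iff, LeavittPathAlgebra.isRightArtinian_iff,
      LeavittPathAlgebra.isLeftArtinian_kroneckerSquare_iff]
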